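/- Let $N\ge 1$ and $d\ge 1$. For a partition $\mu\vdash N$ let $S^\mu$ be the irreducible complex representation (Specht module) of the symmetric group $S(N)$ labelled by $\mu$, with character $\chi^\mu$ and dimension $d_\mu$. Let $V$ be the representation of $S(N)$ on $(\mathbb C^d)^{\otimes N}$ that permutes the tensor factors, let $m_\mu$ be the multiplicity of $S^\mu$ in $V$, and let $P_\mu=\frac{d_\mu}{N!}\sum_{\sigma\in S(N)}\chi^\mu(\sigma^{-1})V(\sigma)$ be the Young projector. The teleportation matrix $M_F$ is the real matrix indexed by the partitions of $N$ with at most $d$ parts whose entry $(M_F)_{\mu\nu}$ is the number of Young frames with $N-1$ boxes that can be obtained both from $\mu$ and from $\nu$ by removing one box. Let $v=(v_\mu)$ be an eigenvector of $M_F$ for its maximal eigenvalue, with $v_\mu\ge 0$ and $\sum_\mu v_\mu^2=1$. Let $|\Phi^+\rangle_{AB}=\bigotimes_{a=1}^N|\psi^+\rangle_{A_aB_a}$, where $|\psi^+\rangle=\frac1{\sqrt d}\sum_{x=1}^d|x\rangle|x\rangle$, be the resource state of non-optimal port-based teleportation (PBT), and let $$|\Phi\rangle_{AB}=(O_A\otimes\mathbf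 1_B)|\Phi^+\rangle_{AB},\qquad O_A=\sqrt{d^N}\sum_{\mu}\frac{v_\mu}{\sqrt{d_\mu m_\mu}}P_\mu,$$ be the resource state of optimal PBT, where the sum is over $\mu\vdash N$ with at most $d$ parts. With the fidelity $F(|\varphi\rangle,|\psi\rangle)=|\langle\varphi|\psi\rangle|$ of pure states, $$F(|\Phi^+\rangle_{AB},|\Phi\rangle_{AB})=\frac1{\sqrt{d^N}}\sum_{\mu}v_\mu\sqrt{d_\mu m_\mu},$$ where again $\mu$ runs over the partitions of $N$ with at most $d$ parts. In the qubit case $d=2$, for $0\le l\le\lfloor N/2\rfloor$ the entry of $v$ at $\mu=(N-l,l)$ is $v^{(N)}_l=u_l/\big(\sum_{k=0}^{\lfloor N/2\rfloor}u_k^2\big)^{1/2}$, where $$u_l=\begin{cases}(-1)^{\frac N2-l}\Big(\sin\frac{(\frac{N+2}2-l)N\pi}{N+2}-\sin\frac{(\frac N2-l)N\pi}{N+2}\Big)\Big/\sin\frac{N\pi}{N+2},& N\text{ even},\\[1ex](-1)^{\frac{N-1}2-l}\sin\frac{(\frac{N+1}2-l)N\pi}{N+2}\Big/\sin\frac{N\pi}{N+2},&N\text{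 odd},\end{cases}$$ and $$F(|\Phi^+\rangle_{AB},|\Phi\rangle_{AB})=\frac1{\sqrt{2^N}}\sum_{l=0}^{\lfloor N/2\rfloor}v_l^{(N)}\frac{N-2l+1}{\sqrt{N+1}}\sqrt{\binom{N+1}{l}}.$$ Equivalently, $$F(|\Phi^+\rangle_{AB},|\Phi\rangle_{AB})=\sqrt{\frac{N!}{2^{N-2}(N+2)}}\sum_{j=j_{\min}}^{N/2}\frac{(2j+1)\sin\frac{\pi(2j+1)}{N+2}}{\sqrt{(\frac N2-j)!\,(\frac N2+j+1)!}},$$ where $j$ runs in unit steps and $j_{\min}=0$ for $N$ even, $j_{\min}=\frac12$ for $N$ odd. -/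

import Mathlib

open scoped Kronecker

noncomputable section

namespace PBT

/-! ### Young frames -/

/-- The Young diagram of a partition: its row lengths are the parts in decreasing order. -/
def diagram {n : ℕ} (μ : n.Partition) : YoungDiagram :=
  YoungDiagram.ofRowLens (μ.parts.sort (· ≥ ·)) (μ.parts.pairwise_sort (· ≥ ·)).sortedGE

/-- Young frames with `N` boxes and height at most `d`: the irreps of `S(N)` that occur
in `(ℂ^d)^{⊗N}`. -/
abbrev Frame (N d : ℕ) : Type := {μ : N.Partition // μ.parts.card ≤ d}

/-- The frame `(N - l, l)`; the second row is absent for `l = 0`. -/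
def twoRow (N l : ℕ) (hl : 2 * l ≤ N) : Frame N 2 :=
  ⟨Nat.Partition.ofSums N {N - l, l} (by
      simp only [Multiset.insert_eq_cons, Multiset.sum_cons, Multiset.sum_singleton]; omega),
    Multiset.card_le_card (Multiset.filter_le _ ({N - l, l} : Multiset ℕ))⟩

/-! ### Representations of the symmetric group -/

/-- The permutation representation `V` of `S(N)` on complex functions on words of length `N`
over `κ`, determined by `V(σ) e_i = e_{i ∘ σ⁻¹}`. For `κ = Fin d` this is `(ℂ^d)^{⊗N}` in its
computational basis. -/
def permRep (N : ℕ) (κ : Type) :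
    Representation ℂ (Equiv.Perm (Fin N)) ((Fin N → κ) → ℂ) where
  toFun σ := LinearMap.funLeft ℂ ℂ (fun i => i ∘ σ)
  map_one' := by ext; rfl
  map_mul' σ τ := by ext; rfl

/-- Young tableaux of shape `μ`: bijective fillings, sending each number to its box
`(row, column)`. -/
abbrev Tableau {N : ℕ} (μ : N.Partition) : Type := Fin N ≃ (diagram μ).cells

/-- The polytabloid `e_t = ∑ sgn(σ) V(σ) {t}`, summed over the column stabiliser of `t`. The
tabloid `{t}` is the word that records the row of every entry of `t`. -/
def polytabloid {N : ℕ} {μ : N.Partition} (t : Tableau μ) : (Fin N → ℕ) → ℂ :=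
  ∑ σ : Equiv.Perm (Fin N) with ∀ i, (t (σ i)).1.2 = (t i).1.2,
    ((Equiv.Perm.sign σ : ℤ) : ℂ) • permRep N ℕ σ (Pi.single (fun i => (t i).1.1) 1)

theorem permRep_single {N : ℕ} {κ : Type} [DecidableEq κ] (σ : Equiv.Perm (Fin N))
    (w : Fin N → κ) :
    permRep N κ σ (Pi.single w 1) = Pi.single (w ∘ σ.symm) 1 := by
  funext i
  have h : i ∘ σ = w ↔ i = w ∘ σ.symm := by
    constructor
    · rintro rfl; funext x; simp
    · rintro rfl; funext x; simp
  simp only [permRep, MonoidHom.coe_mk, OneHom.coe_mk, LinearMap.funLeft_apply, Pi.single_apply, h]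

theorem permRep_polytabloid {N : ℕ} {μ : N.Partition} (π : Equiv.Perm (Fin N)) (t : Tableau μ) :
    permRep N ℕ π (polytabloid t) = polytabloid (π.symm.trans t) := by
  unfold polytabloid
  rw [map_sum]
  refine Finset.sum_bij' (fun σ _ => π * σ * π⁻¹) (fun σ _ => π⁻¹ * σ * π) ?_ ?_ ?_ ?_ ?_
  · intro σ hσ
    simp only [Finset.mem_filter, Finset.mem_univ, true_and] at hσ ⊢
    intro i
    simpa using hσ (π.symm i)
  · intro σ hσ
    simp only [Finset.mem_filter, Finset.mem_univ, true_and] at hσ ⊢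
    intro i
    simpa using hσ (π i)
  · intro σ _; group
  · intro σ _; group
  · intro σ _
    rw [map_smul]
    congr 1
    · simp only [map_mul, map_inv]
      rw [mul_comm, ← mul_assoc]; simp
    · simp only [permRep_single]
      congr 1
      funext i
      have h : (π * σ * π⁻¹).symm i = π (σ.symm (π.symm i)) := rfl
      simp only [Function.comp_apply, Equiv.trans_apply, h, Equiv.symm_apply_apply]

/-- The Specht module `S^μ`, the irrep of `S(N)` labelled by `μ`. -/
def specht {N : ℕ} (μ : N.Partition) : Subrepresentation (permRep N ℕ) where
  toSubmodule := Submodule.span ℂ (Set.range (polytabloid (μ := μ)))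
  apply_mem_toSubmodule π := by
    intro x hx
    induction hx using Submodule.span_induction with
    | mem x hx =>
      obtain ⟨t, rfl⟩ := hx
      rw [permRep_polytabloid]
      exact Submodule.subset_span ⟨_, rfl⟩
    | zero => rw [map_zero]; exact Submodule.zero_mem _
    | add x y _ _ hx hy => rw [map_add]; exact Submodule.add_mem _ hx hy
    | smul a x _ hx => rw [map_smul]; exact Submodule.smul_mem _ a hx

/-- `d_μ`, the dimension of the irrep `μ` of `S(N)`. -/
def dimIrrep {N : ℕ} (μ : N.Partition) : ℕ :=
  Module.finrank ℂ (specht μ).toSubmodule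

/-- `m_μ`, the multiplicity of the irrep `μ` in `(ℂ^d)^{⊗N}`: the dimension of the space of
`S(N)`-equivariant maps from the irrep to `(ℂ^d)^{⊗N}`. -/
def multIrrep {N : ℕ} (d : ℕ) (μ : N.Partition) : ℕ :=
  Module.finrank ℂ
    (Representation.IntertwiningMap (specht μ).toRepresentation (permRep N (Fin d)))

/-- The Young projector `P_μ = (d_μ / N!) ∑_σ χ^μ(σ⁻¹) V(σ)`, in the computational basis. -/
def youngProj {N : ℕ} (d : ℕ) (μ : N.Partition) :
    Matrix (Fin N → Fin d) (Fin N → Fin d) ℂ :=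
  ((dimIrrep μ : ℂ) / (N.factorial : ℂ)) •
    ∑ σ : Equiv.Perm (Fin N),
      (specht μ).toRepresentation.character σ⁻¹ • LinearMap.toMatrix' (permRep N (Fin d) σ)

/-! ### The teleportation matrix -/

/-- The teleportation matrix: the `(μ, ν)` entry is the number of Young frames with `N - 1` boxes
that arise from both `μ` and `ν` by removing one box. On the diagonal this is the number of
removable boxes of `μ`; off the diagonal it is `1` if `ν` arises from `μ` by moving one box and
`0` otherwise. -/
def teleportationMatrix (N d : ℕ) : Matrix (Frame N d) (Frame N d) ℝ :=
  fun μ ν => (Nat.card {α : (N - 1).Partition //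
    diagram α ≤ diagram μ.1 ∧ diagram α ≤ diagram ν.1} : ℝ)

/-- `v` is an entrywise nonnegative, normalised eigenvector of the teleportation matrix for its
maximal eigenvalue. -/
structure IsOptimalVector {N d : ℕ} (v : Frame N d → ℝ) : Prop where
  nonneg : ∀ μ, 0 ≤ v μ
  normalised : ∑ μ, v μ ^ 2 = 1
  eigenvector : ∃ lam : ℝ,
    Module.End.HasEigenvector (Matrix.toLin' (teleportationMatrix N d)) lam v ∧
    ∀ lam' : ℝ, Module.End.HasEigenvalue (Matrix.toLin' (teleportationMatrix N d)) lam' →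
      lam' ≤ lam

/-! ### Resource states -/

/-- The maximally entangled state `|ψ⁺⟩ = d^{-1/2} ∑_x |x⟩|x⟩` on `ℂ^d ⊗ ℂ^d`. -/
def maxEntangled (d : ℕ) : Fin d × Fin d → ℂ :=
  fun p => if p.1 = p.2 then ((1 / √(d : ℝ) : ℝ) : ℂ) else 0

/-- The resource state `|Φ⁺⟩ = ⨂_a |ψ⁺⟩_{A_a B_a}` of non-optimal PBT. The first word indexes
the systems `A = A_1 … A_N`, the second one `B = B_1 … B_N`. -/
def resource (N d : ℕ) : (Fin N → Fin d) × (Fin N → Fin d) → ℂ :=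
  fun p => ∏ a, maxEntangled d (p.1 a, p.2 a)

/-- Alice's operation `O_A = √(d^N) ∑_μ (v_μ / √(d_μ m_μ)) P_μ`. -/
def aliceOp {N d : ℕ} (v : Frame N d → ℝ) : Matrix (Fin N → Fin d) (Fin N → Fin d) ℂ :=
  ((√((d : ℝ) ^ N) : ℝ) : ℂ) •
    ∑ μ : Frame N d,
      ((v μ / √((dimIrrep μ.1 : ℝ) * (multIrrep d μ.1 : ℝ)) : ℝ) : ℂ) • youngProj d μ.1

/-- The resource state `|Φ⟩ = (O_A ⊗ 1_B)|Φ⁺⟩` of optimal PBT. -/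
def optimalResource {N d : ℕ} (v : Frame N d → ℝ) :
    (Fin N → Fin d) × (Fin N → Fin d) → ℂ :=
  (aliceOp v ⊗ₖ (1 : Matrix (Fin N → Fin d) (Fin N → Fin d) ℂ)).mulVec (resource N d)

/-- The fidelity `|⟨φ|ψ⟩|` of two pure states. -/
def fidelity {ι : Type*} [Fintype ι] (φ ψ : ι → ℂ) : ℝ := ‖star φ ⬝ᵥ ψ‖

/-! ### The qubit coefficients -/

/-- The explicit qubit eigenvector, before normalisation. -/
def rawCoeff (N l : ℕ) : ℝ :=
  if Even N then
    (-1) ^ (N / 2 - l) *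
      (Real.sin ((((N : ℝ) + 2) / 2 - l) * N * Real.pi / (N + 2)) -
        Real.sin (((N : ℝ) / 2 - l) * N * Real.pi / (N + 2))) /
      Real.sin (N * Real.pi / (N + 2))
  else
    (-1) ^ ((N - 1) / 2 - l) *
      Real.sin ((((N : ℝ) + 1) / 2 - l) * N * Real.pi / (N + 2)) /
      Real.sin (N * Real.pi / (N + 2))

/-- The normalised coefficient `v_l^{(N)}`. -/
def qubitCoeff (N l : ℕ) : ℝ :=
  rawCoeff N l / √(∑ k ∈ Finset.range (N / 2 + 1), rawCoeff N k ^ 2)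

end PBT

end

noncomputable section

namespace PBT

/-! ### The fidelity as a trace -/

/-! The state `resource N d` is the vectorised identity divided by `√(d^N)`, so its overlap with `(A
⊗ 1)` applied to it is `tr A / d^N`. Since `tr P_μ = d_μ m_μ` by the inner product of characters,
linearity gives the formula for every `d` (`fidelity_resource_optimalResource`).

For `d = 2` a frame is given by the length `l` of its second row, and the teleportation matrix
becomes `BᵀB` with `B` the incidence of adding a box: tridiagonal, with 1 beside the diagonal and 2
on it, except for a 1 where only one box is removable. Put `x = π/(N+2)`. The values
`sin((N+1-2l)x)` are positive and form an eigenvector for `2 + 2 cos 2x`. A nonnegative eigenvector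
pairs nontrivially with it, so by symmetry of the matrix it has the same eigenvalue, and the
three-term recurrence makes the two proportional (`IsOptimalVector.apply_twoRow`).

For `d_μ`, restriction to binary words embeds the Specht module as the span of products of `l`
singlets. This span lies in a space of highest weight functions; splitting by the first letter
bounds the span from below and the larger space from above by the ballot recursion, so both have
dimension `ballot N l` (`finrank_pairSpan`).

For `m_μ`, an equivariant map is determined by its value on one polytabloid, and that value by its
symmetries and its entries at `N - 2l + 1` words. Summation over smaller words, one map for each
number of ones, produces a dual basis (`multIrrep_twoRow`).

The last form of the fidelity uses `∑ sin² = (N+2)/4` and the substitution `k = N - 2l`. -/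

instance finiteDimensional_specht {N : ℕ} (μ : N.Partition) :
    FiniteDimensional ℂ (specht μ).toSubmodule :=
  FiniteDimensional.span_of_finite ℂ (Set.finite_range _)

/-- The normalised sum of products of the two characters is the dimension of the space of
equivariant maps, which is `multIrrep`; the prefactor of the projector supplies `d_μ`. -/
theorem trace_youngProj {N : ℕ} (d : ℕ) (μ : N.Partition) :
    (youngProj d μ).trace = (dimIrrep μ : ℂ) * (multIrrep d μ : ℂ) := by
  have hcard : Nat.card (Equiv.Perm (Fin N)) = N.factorial := by
    rw [Nat.card_eq_fintype_card, Fintype.card_perm, Fintype.card_fin]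
  have hne : (Nat.card (Equiv.Perm (Fin N)) : ℂ) ≠ 0 := by
    rw [hcard]; exact_mod_cast N.factorial_ne_zero
  let := invertibleOfNonzero hne
  have h := Representation.card_inv_mul_sum_char_mul_char_eq_finrank
    (specht μ).toRepresentation (permRep N (Fin d))
  rw [hcard] at h
  rw [youngProj, Matrix.trace_smul, Matrix.trace_sum, multIrrep, ← h, smul_eq_mul, div_eq_mul_inv,
    mul_assoc]
  congr 2
  refine Finset.sum_congr rfl fun σ _ => ?_
  rw [Matrix.trace_smul, smul_eq_mul, mul_comm]
  congr 1
  rw [Representation.character, LinearMap.trace_eq_matrix_trace ℂ (Pi.basisFun ℂ _)]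
  rfl

theorem resource_apply (N d : ℕ) (w u : Fin N → Fin d) :
    resource N d (w, u) = if w = u then ((1 / √((d : ℝ) ^ N) : ℝ) : ℂ) else 0 := by
  unfold resource maxEntangled
  split_ifs with h
  · subst h
    have hpow : √((d : ℝ) ^ N) = √(d : ℝ) ^ N := by
      rw [Real.sqrt_eq_iff_mul_self_eq (by positivity) (by positivity), ← mul_pow,
        Real.mul_self_sqrt (by positivity)]
    simp [hpow]
  · obtain ⟨a, ha⟩ := Function.ne_iff.1 h
    exact Finset.prod_eq_zero (Finset.mem_univ a) (if_neg ha)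

theorem star_resource_dotProduct_kronecker_mulVec (N d : ℕ)
    (A : Matrix (Fin N → Fin d) (Fin N → Fin d) ℂ) :
    star (resource N d) ⬝ᵥ
      (A ⊗ₖ (1 : Matrix (Fin N → Fin d) (Fin N → Fin d) ℂ)).mulVec (resource N d) =
      ((1 / (d : ℝ) ^ N : ℝ) : ℂ) * A.trace := by
  have hsq : ((1 / √((d : ℝ) ^ N) : ℝ) : ℂ) * ((1 / √((d : ℝ) ^ N) : ℝ) : ℂ) =
      ((1 / (d : ℝ) ^ N : ℝ) : ℂ) := by
    rw [← Complex.ofReal_mul, div_mul_div_comm, one_mul, Real.mul_self_sqrt (by positivity)]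
  simp only [dotProduct, Matrix.mulVec, Fintype.sum_prod_type, Pi.star_apply, resource_apply,
    Matrix.kroneckerMap_apply, Matrix.one_apply, Matrix.trace, Matrix.diag_apply, Finset.mul_sum]
  refine Finset.sum_congr rfl fun w _ => ?_
  rw [Finset.sum_eq_single w]
  · rw [Finset.sum_eq_single w, Finset.sum_eq_single w]
    · simp only [if_true, Complex.star_def, Complex.conj_ofReal, mul_one]
      rw [← hsq]; ring
    · intro u _ hu; simp [hu.symm]
    · simp
    · intro u _ hu
      refine Finset.mul_sum _ _ _ |>.symm.trans ?_
      rw [Finset.sum_eq_zero, mul_zero]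
      intro x _
      by_cases hx : w = x
      · subst hx; simp [hu]
      · simp [hx]
    · simp
  · intro u _ hu; simp [hu.symm]
  · simp

theorem fidelity_resource_optimalResource {N d : ℕ} {v : Frame N d → ℝ} (hv : ∀ μ, 0 ≤ v μ) :
    fidelity (resource N d) (optimalResource v) =
      1 / √((d : ℝ) ^ N) *
        ∑ μ : Frame N d, v μ * √((dimIrrep μ.1 : ℝ) * (multIrrep d μ.1 : ℝ)) := by
  have htr : (aliceOp v).trace = ((√((d : ℝ) ^ N) * ∑ μ : Frame N d,
      v μ * √((dimIrrep μ.1 : ℝ) * (multIrrep d μ.1 : ℝ)) : ℝ) : ℂ) := by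
    rw [aliceOp, Matrix.trace_smul, Matrix.trace_sum, smul_eq_mul, Complex.ofReal_mul,
      Complex.ofReal_sum]
    congr 1
    refine Finset.sum_congr rfl fun μ _ => ?_
    rw [Matrix.trace_smul, trace_youngProj, smul_eq_mul, ← Complex.ofReal_natCast,
      ← Complex.ofReal_natCast, ← Complex.ofReal_mul, ← Complex.ofReal_mul, div_mul_eq_mul_div,
      mul_div_assoc, Real.div_sqrt]
  rw [fidelity, optimalResource, star_resource_dotProduct_kronecker_mulVec, htr,
    -- The trace is real, and entrywise nonnegativity of `v` lets the modulus be dropped.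
    ← Complex.ofReal_mul, Complex.norm_real, Real.norm_eq_abs, ← mul_assoc, abs_of_nonneg]
  · congr 1
    rw [div_mul_eq_mul_div, one_mul, Real.sqrt_div_self']
  · exact mul_nonneg (by positivity)
      (Finset.sum_nonneg fun μ _ => mul_nonneg (hv μ) (Real.sqrt_nonneg _))

/-! ### Two-row frames -/

theorem sort_parts_twoRow (n l : ℕ) (hl : 2 * l ≤ n) :
    (twoRow n l hl).1.parts.sort (· ≥ ·) = [n - l, l].filter (· ≠ 0) := by
  refine List.Perm.eq_of_pairwise' (r := (· ≥ ·)) (Multiset.pairwise_sort _ _) ?_ ?_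
  · refine List.Pairwise.filter _ ?_
    simp; omega
  · rw [← Multiset.coe_eq_coe, Multiset.sort_eq]
    rfl

/-- One description covers `l = 0` and `n = 0` too, where `Nat.Partition.ofSums` drops the zero
parts and the list of rows is shorter. -/
theorem mem_diagram_twoRow {n l : ℕ} {hl : 2 * l ≤ n} {c : ℕ × ℕ} :
    c ∈ diagram (twoRow n l hl).1 ↔ c.1 = 0 ∧ c.2 < n - l ∨ c.1 = 1 ∧ c.2 < l := by
  rw [diagram, YoungDiagram.mem_ofRowLens]
  simp only [sort_parts_twoRow]
  obtain ⟨i, j⟩ := c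
  by_cases h0 : l = 0
  · subst h0
    by_cases hn : n = 0
    · subst hn; simp
    · simp [hn]
  · have h1 : n - l ≠ 0 := by omega
    simp [h0, h1]
    rcases i with _ | _ | i
    · simp
    · simp
    · simp

theorem mem_diagram_zero_right {n : ℕ} (α : n.Partition) (i : ℕ) :
    (i, 0) ∈ diagram α ↔ i < α.parts.card := by
  rw [diagram, YoungDiagram.mem_ofRowLens]
  simp only [Multiset.length_sort]
  constructor
  · rintro ⟨h, -⟩; exact h
  · intro h
    exact ⟨h, α.parts_pos ((Multiset.mem_sort _).1 (List.getElem_mem _))⟩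

theorem exists_eq_twoRow {n : ℕ} (α : n.Partition) (hα : α.parts.card ≤ 2) :
    ∃ (l : ℕ) (hl : 2 * l ≤ n), α = (twoRow n l hl).1 := by
  have hpos : ∀ {i}, i ∈ α.parts → 0 < i := α.parts_pos
  have hsum := α.parts_sum
  suffices ∃ (l : ℕ) (hl : 2 * l ≤ n), α.parts = ({n - l, l} : Multiset ℕ).filter (· ≠ 0) by
    obtain ⟨l, hl, h⟩ := this
    exact ⟨l, hl, Nat.Partition.ext h⟩
  interval_cases h : α.parts.card
  · rw [Multiset.card_eq_zero] at h
    rw [h] at hsum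
    simp only [Multiset.sum_zero] at hsum
    subst hsum
    exact ⟨0, by simp, by rw [h]; rfl⟩
  · obtain ⟨a, ha⟩ := Multiset.card_eq_one.1 h
    have h0 := hpos (i := a) (by simp [ha])
    rw [ha] at hsum ⊢
    simp only [Multiset.sum_singleton] at hsum
    subst hsum
    refine ⟨0, by simp, ?_⟩
    simp [Multiset.filter_cons_of_pos, Multiset.filter_singleton, h0.ne']
  · obtain ⟨a, b, ha⟩ := Multiset.card_eq_two.1 h
    have h0 := hpos (i := a) (by simp [ha])
    have h1 := hpos (i := b) (by simp [ha])
    rw [ha] at hsum ⊢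
    simp only [Multiset.insert_eq_cons, Multiset.sum_cons, Multiset.sum_singleton] at hsum
    subst hsum
    rcases le_total b a with hab | hab
    · refine ⟨b, by omega, ?_⟩
      simp [Multiset.filter_cons_of_pos, Multiset.filter_singleton, h0.ne', h1.ne']
    · refine ⟨a, by omega, ?_⟩
      simp [Multiset.filter_cons_of_pos, Multiset.filter_singleton, h0.ne', h1.ne']
      exact Multiset.pair_comm a b

theorem twoRow_inj {n l k : ℕ} {hl : 2 * l ≤ n} {hk : 2 * k ≤ n}
    (h : (twoRow n l hl).1 = (twoRow n k hk).1) : l = k := by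
  have hmem (j : ℕ) : j < l ↔ j < k := by
    have h1 : (1, j) ∈ diagram (twoRow n l hl).1 ↔ (1, j) ∈ diagram (twoRow n k hk).1 := by rw [h]
    simpa [mem_diagram_twoRow] using h1
  exact le_antisymm (not_lt.1 fun h' => lt_irrefl _ ((hmem k).1 h'))
    (not_lt.1 fun h' => lt_irrefl _ ((hmem l).2 h'))

/-- Frames with at most two rows are labelled by the length of the second row. -/
def twoRowEquiv (N : ℕ) : Fin (N / 2 + 1) ≃ Frame N 2 :=
  Equiv.ofBijective (fun l => twoRow N l (by omega))
    ⟨fun _ _ h => Fin.ext (twoRow_inj (congrArg Subtype.val h)), fun μ => by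
      obtain ⟨l, hl, h⟩ := exists_eq_twoRow μ.1 μ.2
      exact ⟨⟨l, by omega⟩, Subtype.ext h.symm⟩⟩

/-- Containment means `k ≤ l` and `N - 1 - k ≤ N - l`. The boxes tested are the first ones beyond
the ends of the rows of the larger frame. -/
theorem diagram_twoRow_le_iff {N l k : ℕ} (hN : 1 ≤ N) {hl : 2 * l ≤ N} {hk : 2 * k ≤ N - 1} :
    diagram (twoRow (N - 1) k hk).1 ≤ diagram (twoRow N l hl).1 ↔ l = k ∨ l = k + 1 := by
  rw [← YoungDiagram.cells_subset_iff]
  constructor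
  · intro h
    have h0 : ¬ (N - l < N - 1 - k) := by
      intro hlt
      have := h (x := (0, N - l)) (by
        rw [YoungDiagram.mem_cells, mem_diagram_twoRow]; simp; omega)
      rw [YoungDiagram.mem_cells, mem_diagram_twoRow] at this
      simp at this
    have h1 : ¬ (l < k) := by
      intro hlt
      have := h (x := (1, l)) (by
        rw [YoungDiagram.mem_cells, mem_diagram_twoRow]; simp; omega)
      rw [YoungDiagram.mem_cells, mem_diagram_twoRow] at this
      simp at this
    omega
  · intro h c hc
    rw [YoungDiagram.mem_cells, mem_diagram_twoRow] at hc ⊢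
    omega

/-- The incidence of the second rows of a frame with `N - 1` boxes and a frame with `N` boxes:
whether adding a box turns the former into the latter. -/
def addBox (k l : ℕ) : ℝ := if l = k ∨ l = k + 1 then 1 else 0

/-- This is the factorisation `BᵀB`: each common subframe contributes one product of incidences. -/
theorem teleportationMatrix_twoRow {N l m : ℕ} (hN : 1 ≤ N) (hl : 2 * l ≤ N) (hm : 2 * m ≤ N) :
    teleportationMatrix N 2 (twoRow N l hl) (twoRow N m hm) =
      ∑ k ∈ Finset.range ((N - 1) / 2 + 1), addBox k l * addBox k m := by
  have key : Nat.card {α : (N - 1).Partition //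
      diagram α ≤ diagram (twoRow N l hl).1 ∧ diagram α ≤ diagram (twoRow N m hm).1} =
      Nat.card {k : Fin ((N - 1) / 2 + 1) //
        (l = k.1 ∨ l = k.1 + 1) ∧ (m = k.1 ∨ m = k.1 + 1)} := by
    refine (Nat.card_congr (Equiv.ofBijective
      (fun k => ⟨(twoRow (N - 1) k.1.1 (by omega)).1,
        (diagram_twoRow_le_iff hN).2 k.2.1, (diagram_twoRow_le_iff hN).2 k.2.2⟩)
      ⟨fun a b h => ?_, ?_⟩)).symm
    · have h' := Subtype.ext_iff.1 h
      exact Subtype.ext (Fin.ext (twoRow_inj (hl := by omega) (hk := by omega) h'))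
    rintro ⟨α, h1, h2⟩
    -- A third row would put the box `(2, 0)` into a two-row frame.
    have hα : α.parts.card ≤ 2 := by
      by_contra! hlt
      have := h1 ((mem_diagram_zero_right α 2).2 hlt)
      rw [mem_diagram_twoRow] at this
      simp at this
    obtain ⟨k, hk, rfl⟩ := exists_eq_twoRow α hα
    exact ⟨⟨⟨k, by omega⟩, (diagram_twoRow_le_iff hN).1 h1, (diagram_twoRow_le_iff hN).1 h2⟩, rfl⟩
  rw [teleportationMatrix, key, Nat.card_eq_fintype_card, Fintype.card_subtype,
    Finset.card_filter, Nat.cast_sum,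
    ← Fin.sum_univ_eq_sum_range (fun k => addBox k l * addBox k m)]
  refine Finset.sum_congr rfl fun k _ => ?_
  unfold addBox
  split_ifs <;> simp_all

/-! ### The qubit eigenvector -/

/-- The entries of the positive eigenvector of the qubit teleportation matrix, up to scale. -/
def sineCoeff (N l : ℕ) : ℝ := Real.sin (((N : ℝ) + 1 - 2 * l) * (Real.pi / (N + 2)))

theorem sineCoeff_pos {N l : ℕ} (hl : 2 * l ≤ N) : 0 < sineCoeff N l := by
  have hl' : (2 * l : ℝ) ≤ N := by exact_mod_cast hl
  have hpi := Real.pi_pos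
  refine Real.sin_pos_of_pos_of_lt_pi (by apply mul_pos; linarith; positivity) ?_
  rw [← mul_div_assoc, div_lt_iff₀ (by positivity), mul_comm Real.pi]
  refine mul_lt_mul_of_pos_right ?_ hpi
  have : (0 : ℝ) ≤ l := by positivity
  linarith

/-- With `x = π/(N+2)` one has `Nπ/(N+2) = π - 2x`; this is the origin of the alternating signs in
`rawCoeff`. -/
theorem sin_sub_mul_pi_sub (m : ℕ) (x : ℝ) :
    Real.sin (m * (Real.pi - 2 * x)) = -((-1) ^ m * Real.sin (2 * m * x)) := by
  rw [show m * (Real.pi - 2 * x) = m * Real.pi - 2 * m * x by ring, Real.sin_nat_mul_pi_sub]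

/-- The signs cancel. For even `N` and `m = N/2 - l` the numerator is `sin((2m+2)x) + sin(2mx) = 2
sin((2m+1)x) cos x`, and dividing by `sin 2x` leaves the factor `1 / sin x`; for odd `N` the factor
is `1 / sin 2x`. -/
theorem exists_rawCoeff_eq (N : ℕ) (hN : 1 ≤ N) :
    ∃ c : ℝ, 0 < c ∧ ∀ l, 2 * l ≤ N → rawCoeff N l = c * sineCoeff N l := by
  have hpi := Real.pi_pos
  have hN' : (1 : ℝ) ≤ N := by exact_mod_cast hN
  set x : ℝ := Real.pi / (N + 2) with hx
  have hx0 : 0 < x := by positivity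
  have hxN : x * (N + 2) = Real.pi := by rw [hx]; field_simp
  have harg : ∀ y : ℝ, y * N * Real.pi / (N + 2) = y * (Real.pi - 2 * x) := by
    intro y; rw [hx]; field_simp; ring
  have hden : Real.sin (N * Real.pi / (N + 2)) = Real.sin (2 * x) := by
    have := harg 1
    rw [one_mul, one_mul] at this
    rw [this, Real.sin_pi_sub]
  have hx2 : 0 < Real.sin (2 * x) :=
    Real.sin_pos_of_pos_of_lt_pi (by positivity) (by nlinarith)
  have hsx : 0 < Real.sin x := Real.sin_pos_of_pos_of_lt_pi hx0 (by nlinarith)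
  have hcx : 0 < Real.cos x := Real.cos_pos_of_mem_Ioo ⟨by linarith, by nlinarith⟩
  rcases Nat.even_or_odd' N with ⟨M, hM | hM⟩
  · refine ⟨1 / Real.sin x, by positivity, fun l hl => ?_⟩
    obtain ⟨m, rfl⟩ : ∃ m, M = l + m := Nat.exists_eq_add_of_le (by omega)
    have hc : (N : ℝ) = 2 * (l + m) := by rw [hM]; push_cast; ring
    have e1 : (((N : ℝ) + 2) / 2 - l) = ((m + 1 : ℕ) : ℝ) := by rw [hc]; push_cast; ring
    have e2 : ((N : ℝ) / 2 - l) = (m : ℝ) := by rw [hc]; ring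
    rw [rawCoeff, if_pos ⟨l + m, by omega⟩, harg, harg, hden, e1, e2, sin_sub_mul_pi_sub,
      sin_sub_mul_pi_sub, show N / 2 - l = m by omega, sineCoeff, ← hx,
      show ((N : ℝ) + 1 - 2 * l) * x = (2 * m + 1) * x by rw [hc]; ring, Real.sin_two_mul,
      show 2 * ((m + 1 : ℕ) : ℝ) * x = (2 * m + 1) * x + x by push_cast; ring,
      show 2 * (m : ℝ) * x = (2 * m + 1) * x - x by ring, Real.sin_add, Real.sin_sub]
    have hs : ((-1 : ℝ) ^ m) * (-1) ^ m = 1 := by rw [← mul_pow]; simp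
    rw [pow_succ]
    field_simp
    linear_combination (2 * Real.sin ((2 * m + 1) * x) * Real.cos x) * hs
  · refine ⟨1 / Real.sin (2 * x), by positivity, fun l hl => ?_⟩
    obtain ⟨m, rfl⟩ : ∃ m, M = l + m := Nat.exists_eq_add_of_le (by omega)
    have hc : (N : ℝ) = 2 * (l + m) + 1 := by rw [hM]; push_cast; ring
    have e1 : (((N : ℝ) + 1) / 2 - l) = ((m + 1 : ℕ) : ℝ) := by rw [hc]; push_cast; ring
    rw [rawCoeff, if_neg (by rw [Nat.not_even_iff_odd]; exact ⟨l + m, hM⟩), harg, hden, e1,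
      sin_sub_mul_pi_sub, show (N - 1) / 2 - l = m by omega, sineCoeff, ← hx,
      show ((N : ℝ) + 1 - 2 * l) * x = 2 * ((m + 1 : ℕ) : ℝ) * x by rw [hc]; push_cast; ring]
    have hs : ((-1 : ℝ) ^ m) * (-1) ^ m = 1 := by rw [← mul_pow]; simp
    rw [pow_succ]
    field_simp
    linear_combination (Real.sin (2 * ((m + 1 : ℕ) : ℝ) * x)) * hs

theorem sum_sineCoeff_sq (N : ℕ) (hN : 1 ≤ N) :
    ∑ l ∈ Finset.range (N / 2 + 1), sineCoeff N l ^ 2 = ((N : ℝ) + 2) / 4 := by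
  have hpi := Real.pi_pos
  have hN' : (1 : ℝ) ≤ N := by exact_mod_cast hN
  set x : ℝ := Real.pi / (N + 2) with hx
  have hx0 : 0 < x := by positivity
  have hxN : x * (N + 2) = Real.pi := by rw [hx]; field_simp
  have hx2 : 0 < Real.sin (2 * x) :=
    Real.sin_pos_of_pos_of_lt_pi (by positivity) (by nlinarith)
  -- Multiplication by `sin 2x` makes the sum of cosines telescope.
  have key : ∀ n : ℕ, Real.sin (2 * x) * ∑ l ∈ Finset.range n, sineCoeff N l ^ 2 =
      Real.sin (2 * x) * n / 2 - Real.sin (4 * n * x) / 4 := by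
    intro n
    induction n with
    | zero => simp
    | succ n ih =>
      have h1 : sineCoeff N n ^ 2 = (1 - Real.cos ((4 * n + 2) * x)) / 2 := by
        rw [sineCoeff, ← hx, Real.sin_sq_eq_half_sub, ← Real.cos_two_pi_sub ((4 * n + 2) * x),
          ← hxN]
        ring_nf
      have h2 : Real.sin (4 * (n + 1 : ℕ) * x) =
          Real.sin (4 * n * x) + 2 * Real.sin (2 * x) * Real.cos ((4 * n + 2) * x) := by
        rw [show 4 * ((n + 1 : ℕ) : ℝ) * x = (4 * n + 2) * x + 2 * x by push_cast; ring,
          show 4 * (n : ℝ) * x = (4 * n + 2) * x - 2 * x by ring, Real.sin_add, Real.sin_sub]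
        ring
      rw [Finset.sum_range_succ, mul_add, ih, h1, h2]
      push_cast
      ring
  refine mul_left_cancel₀ hx2.ne' ?_
  rw [key]
  -- At `n = N/2 + 1` the boundary angle is `2π` for even `N` and `2π - 2x` for odd `N`; the latter
  -- adds the missing quarter.
  rcases Nat.even_or_odd' N with ⟨M, hM | hM⟩
  · have hc : (N : ℝ) = 2 * M := by rw [hM]; push_cast; ring
    rw [show N / 2 + 1 = M + 1 by omega,
      show 4 * ((M + 1 : ℕ) : ℝ) * x = 2 * Real.pi by rw [← hxN, hc]; push_cast; ring,
      Real.sin_two_pi, hc]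
    push_cast
    ring
  · have hc : (N : ℝ) = 2 * M + 1 := by rw [hM]; push_cast; ring
    rw [show N / 2 + 1 = M + 1 by omega,
      show 4 * ((M + 1 : ℕ) : ℝ) * x = 2 * Real.pi - 2 * x by rw [← hxN, hc]; push_cast; ring,
      Real.sin_two_pi_sub, hc]
    push_cast
    ring

theorem qubitCoeff_eq {N l : ℕ} (hN : 1 ≤ N) (hl : 2 * l ≤ N) :
    qubitCoeff N l = sineCoeff N l / √(∑ k ∈ Finset.range (N / 2 + 1), sineCoeff N k ^ 2) := by
  obtain ⟨c, hc, h⟩ := exists_rawCoeff_eq N hN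
  have hsum : ∑ k ∈ Finset.range (N / 2 + 1), rawCoeff N k ^ 2 =
      c ^ 2 * ∑ k ∈ Finset.range (N / 2 + 1), sineCoeff N k ^ 2 := by
    rw [Finset.mul_sum]
    refine Finset.sum_congr rfl fun k hk => ?_
    rw [Finset.mem_range] at hk
    rw [h k (by omega), mul_pow]
  rw [qubitCoeff, hsum, h l hl, Real.sqrt_mul (sq_nonneg c), Real.sqrt_sq hc.le,
    mul_div_mul_left _ _ hc.ne']

/-- The action of the qubit teleportation matrix on sequences indexed by the second row. -/
def teleportRow (N : ℕ) (x : ℕ → ℝ) (l : ℕ) : ℝ :=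
  ∑ m ∈ Finset.range (N / 2 + 1),
    (∑ k ∈ Finset.range ((N - 1) / 2 + 1), addBox k l * addBox k m) * x m

/-- Symmetry of the matrix, which forces eigenvectors with nonzero pairing to share their
eigenvalue. -/
theorem sum_teleportRow_mul (N : ℕ) (x z : ℕ → ℝ) :
    ∑ l ∈ Finset.range (N / 2 + 1), teleportRow N x l * z l =
      ∑ l ∈ Finset.range (N / 2 + 1), x l * teleportRow N z l := by
  simp only [teleportRow, Finset.sum_mul, Finset.mul_sum]
  rw [Finset.sum_comm]
  refine Finset.sum_congr rfl fun l _ => Finset.sum_congr rfl fun m _ =>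
    Finset.sum_congr rfl fun k _ => ?_
  ring

section Rows

variable {N : ℕ} {x : ℕ → ℝ}

theorem teleportRow_eq (hN : 1 ≤ N) (hx : ∀ k, N < 2 * k → x k = 0) (l : ℕ) :
    teleportRow N x l =
      ∑ k ∈ Finset.range ((N - 1) / 2 + 1), addBox k l * (x k + x (k + 1)) := by
  simp only [teleportRow, Finset.sum_mul]
  rw [Finset.sum_comm]
  refine Finset.sum_congr rfl fun k hk => ?_
  rw [Finset.mem_range] at hk
  simp only [mul_assoc, ← Finset.mul_sum]
  congr 1
  have hB : ∀ m, addBox k m * x m = (if m = k then x m else 0) + if m = k + 1 then x m else 0 := by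
    intro m
    unfold addBox
    split_ifs <;> simp_all
  simp only [hB, Finset.sum_add_distrib, Finset.sum_ite_eq', Finset.mem_range]
  rw [if_pos (by omega)]
  split_ifs with h
  · rfl
  -- This occurs only for odd `N` and the last `k`, where the second row cannot grow.
  · rw [hx (k + 1) (by omega)]

theorem teleportRow_zero (hN : 1 ≤ N) (hx : ∀ k, N < 2 * k → x k = 0) :
    teleportRow N x 0 = x 0 + x 1 := by
  rw [teleportRow_eq hN hx, Finset.sum_eq_single 0]
  · simp [addBox]
  · intro k _ hk
    simp [addBox, hk.symm]
  · simp

theorem sum_addBox_succ (y : ℕ → ℝ) (n p : ℕ) :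
    ∑ k ∈ Finset.range n, addBox k (p + 1) * y k =
      (if p < n then y p else 0) + if p + 1 < n then y (p + 1) else 0 := by
  have hB : ∀ k, addBox k (p + 1) * y k =
      (if k = p then y k else 0) + if k = p + 1 then y k else 0 := by
    intro k
    unfold addBox
    split_ifs <;> first | omega | simp
  simp only [hB, Finset.sum_add_distrib, Finset.sum_ite_eq', Finset.mem_range]

theorem teleportRow_succ (hx : ∀ k, N < 2 * k → x k = 0) {p : ℕ} (hp : 2 * (p + 1) < N) :
    teleportRow N x (p + 1) = x p + 2 * x (p + 1) + x (p + 2) := by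
  rw [teleportRow_eq (by omega) hx, sum_addBox_succ, if_pos (by omega), if_pos (by omega)]
  ring

/-- The rectangle `(N/2, N/2)` has a single removable box, so the diagonal entry drops from 2 to 1.
-/
theorem teleportRow_last (hx : ∀ k, N < 2 * k → x k = 0) {p : ℕ} (hp : 2 * (p + 1) = N) :
    teleportRow N x (p + 1) = x p + x (p + 1) := by
  rw [teleportRow_eq (by omega) hx, sum_addBox_succ, if_pos (by omega), if_neg (by omega), add_zero]

end Rows

/-! ### The sine eigenvector of the tridiagonal matrix -/

theorem sineCoeff_add_sineCoeff (N p : ℕ) :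
    sineCoeff N p + sineCoeff N (p + 2) =
      2 * Real.cos (2 * (Real.pi / (N + 2))) * sineCoeff N (p + 1) := by
  unfold sineCoeff
  set x : ℝ := Real.pi / (N + 2)
  rw [show ((N : ℝ) + 1 - 2 * p) * x = ((N : ℝ) + 1 - 2 * (p + 1 : ℕ)) * x + 2 * x by
      push_cast; ring,
    show ((N : ℝ) + 1 - 2 * (p + 2 : ℕ)) * x = ((N : ℝ) + 1 - 2 * (p + 1 : ℕ)) * x - 2 * x by
      push_cast; ring, Real.sin_add, Real.sin_sub]
  ring

/-- The boundary condition at `l = 0`: since `(N+2)x = π`, it reads `sin 3x = (1 + 2 cos 2x) sin x`.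
-/
theorem sineCoeff_one (N : ℕ) :
    sineCoeff N 1 = (1 + 2 * Real.cos (2 * (Real.pi / (N + 2)))) * sineCoeff N 0 := by
  unfold sineCoeff
  set x : ℝ := Real.pi / (N + 2) with hx
  have hxN : x * (N + 2) = Real.pi := by rw [hx]; field_simp
  rw [show ((N : ℝ) + 1 - 2 * (1 : ℕ)) * x = Real.pi - (x + 2 * x) by
      rw [← hxN]; push_cast; ring,
    show ((N : ℝ) + 1 - 2 * (0 : ℕ)) * x = Real.pi - x by rw [← hxN]; push_cast; ring,
    Real.sin_pi_sub, Real.sin_pi_sub, Real.sin_add, Real.sin_two_mul, Real.cos_two_mul]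
  ring

/-- `sineCoeff`, cut off where the frames `(N - l, l)` end. -/
def sineVec (N l : ℕ) : ℝ := if 2 * l ≤ N then sineCoeff N l else 0

theorem sineVec_of_le {N l : ℕ} (hl : 2 * l ≤ N) : sineVec N l = sineCoeff N l := if_pos hl

theorem sineVec_of_lt {N l : ℕ} (hl : N < 2 * l) : sineVec N l = 0 := if_neg (by omega)

/-- For odd `N` the sine vanishes at `l = (N+1)/2`, so the cut-off changes nothing one step past the
last frame. -/
theorem sineVec_eq_sineCoeff {N l : ℕ} (hl : 2 * l ≤ N + 1) : sineVec N l = sineCoeff N l := by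
  rcases Nat.lt_or_ge N (2 * l) with h | h
  · have h2 : (2 * l : ℝ) = N + 1 := by exact_mod_cast le_antisymm hl h
    rw [sineVec_of_lt h, sineCoeff, h2, sub_self, zero_mul, Real.sin_zero]
  · exact sineVec_of_le h

theorem teleportRow_sineVec {N l : ℕ} (hN : 1 ≤ N) (hl : 2 * l ≤ N) :
    teleportRow N (sineVec N) l =
      (2 + 2 * Real.cos (2 * (Real.pi / (N + 2)))) * sineVec N l := by
  have hx : ∀ k, N < 2 * k → sineVec N k = 0 := fun k => sineVec_of_lt
  rcases l with _ | p
  · rw [teleportRow_zero hN hx, sineVec_eq_sineCoeff (by omega), sineVec_eq_sineCoeff (by omega),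
      sineCoeff_one]
    ring
  · rcases hl.lt_or_eq with h | h
    · rw [teleportRow_succ hx h, sineVec_eq_sineCoeff (by omega), sineVec_eq_sineCoeff (by omega),
        sineVec_eq_sineCoeff (by omega)]
      linear_combination sineCoeff_add_sineCoeff N p
    · rw [teleportRow_last hx h, sineVec_eq_sineCoeff (by omega), sineVec_eq_sineCoeff (by omega)]
      -- The angles are `-x` and `x`: oddness of the sine gives the boundary condition at the
      -- rectangular frame.
      have h2 : sineCoeff N (p + 2) = -sineCoeff N (p + 1) := by
        have hc : (N : ℝ) = 2 * (p + 1) := by rw [← h]; push_cast; ring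
        rw [sineCoeff, sineCoeff, ← Real.sin_neg, hc]
        congr 1
        push_cast
        ring
      linear_combination sineCoeff_add_sineCoeff N p - h2

/-- The entries beside the diagonal are 1, so row `l` of the eigenvalue equation determines entry `l
+ 1` from earlier ones, and entry 0 determines all. The cross-multiplied form avoids division. -/
theorem teleportRow_eigenvector_unique {N : ℕ} {x z : ℕ → ℝ} {lam : ℝ} (hN : 1 ≤ N)
    (hx : ∀ k, N < 2 * k → x k = 0) (hz : ∀ k, N < 2 * k → z k = 0)
    (ex : ∀ l, 2 * l ≤ N → teleportRow N x l = lam * x l)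
    (ez : ∀ l, 2 * l ≤ N → teleportRow N z l = lam * z l) (l : ℕ) (hl : 2 * l ≤ N) :
    x l * z 0 = z l * x 0 := by
  induction l using Nat.strong_induction_on with
  | _ l ih =>
    rcases l with _ | _ | p
    · ring
    · have h1 := ex 0 (by omega)
      have h2 := ez 0 (by omega)
      rw [teleportRow_zero hN hx] at h1
      rw [teleportRow_zero hN hz] at h2
      rw [zero_add]
      linear_combination h1 * z 0 - h2 * x 0
    · have h1 := ex (p + 1) (by omega)
      have h2 := ez (p + 1) (by omega)
      rw [teleportRow_succ hx (by omega)] at h1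
      rw [teleportRow_succ hz (by omega)] at h2
      have i1 := ih p (by omega) (by omega)
      have i2 := ih (p + 1) (by omega) (by omega)
      linear_combination h1 * z 0 - h2 * x 0 - i1 + (lam - 2) * i2

theorem sum_frame_eq_sum_range {N : ℕ} {f : Frame N 2 → ℝ} {g : ℕ → ℝ}
    (h : ∀ l (hl : 2 * l ≤ N), f (twoRow N l hl) = g l) :
    ∑ μ, f μ = ∑ l ∈ Finset.range (N / 2 + 1), g l := by
  rw [← Fin.sum_univ_eq_sum_range g, ← (twoRowEquiv N).sum_comp]
  exact Finset.sum_congr rfl fun l _ => h l (by omega)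

theorem IsOptimalVector.apply_twoRow {N : ℕ} (hN : 1 ≤ N) {v : Frame N 2 → ℝ}
    (hv : IsOptimalVector v) (l : ℕ) (hl : 2 * l ≤ N) :
    v (twoRow N l hl) = qubitCoeff N l := by
  obtain ⟨lam, hlam, -⟩ := hv.eigenvector
  set x : ℕ → ℝ := fun l => if h : 2 * l ≤ N then v (twoRow N l h) else 0 with hxdef
  have hxv : ∀ l (hl : 2 * l ≤ N), v (twoRow N l hl) = x l := fun l hl => by simp [hxdef, hl]
  have hx0 : ∀ k, N < 2 * k → x k = 0 := fun k hk => by simp [hxdef, hk]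
  have hxn : ∀ l, 0 ≤ x l := by
    intro l
    rcases Nat.lt_or_ge N (2 * l) with h | h
    · exact (hx0 l h).ge
    · rw [← hxv l h]; exact hv.nonneg _
  have hsq : ∑ l ∈ Finset.range (N / 2 + 1), x l ^ 2 = 1 := by
    rw [← hv.normalised]
    exact (sum_frame_eq_sum_range fun l hl => by rw [hxv]).symm
  have ex : ∀ l, 2 * l ≤ N → teleportRow N x l = lam * x l := by
    intro l hl
    have h := congrFun hlam.apply_eq_smul (twoRow N l hl)
    rw [Matrix.toLin'_apply, Matrix.mulVec, dotProduct, Pi.smul_apply, smul_eq_mul, hxv] at h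
    rw [← h, teleportRow]
    refine (sum_frame_eq_sum_range fun m hm => ?_).symm
    rw [teleportationMatrix_twoRow hN, hxv]
  have ha : ∀ k, N < 2 * k → sineVec N k = 0 := fun k => sineVec_of_lt
  have hapos : ∀ l ∈ Finset.range (N / 2 + 1), 0 < sineVec N l := fun l hl => by
    rw [Finset.mem_range] at hl
    rw [sineVec_of_le (by omega)]; exact sineCoeff_pos (by omega)
  -- A nonnegative nonzero vector has positive pairing with a strictly positive one; this factor is
  -- cancelled to identify the eigenvalue.
  have hpos : 0 < ∑ l ∈ Finset.range (N / 2 + 1), x l * sineVec N l := by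
    refine lt_of_le_of_ne (Finset.sum_nonneg fun l hl => mul_nonneg (hxn l) (hapos l hl).le) ?_
    intro h0
    have h1 := (Finset.sum_eq_zero_iff_of_nonneg fun l hl =>
      mul_nonneg (hxn l) (hapos l hl).le).1 h0.symm
    rw [Finset.sum_eq_zero] at hsq
    · exact zero_ne_one hsq
    · intro l hl
      have := (mul_eq_zero.1 (h1 l hl)).resolve_right (hapos l hl).ne'
      rw [this]; simp
  have hlameq : lam = 2 + 2 * Real.cos (2 * (Real.pi / (N + 2))) := by
    have h := sum_teleportRow_mul N x (sineVec N)
    have e1 : ∑ l ∈ Finset.range (N / 2 + 1), teleportRow N x l * sineVec N l =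
        lam * ∑ l ∈ Finset.range (N / 2 + 1), x l * sineVec N l := by
      rw [Finset.mul_sum]
      refine Finset.sum_congr rfl fun l hl => ?_
      rw [Finset.mem_range] at hl
      rw [ex l (by omega), mul_assoc]
    have e2 : ∑ l ∈ Finset.range (N / 2 + 1), x l * teleportRow N (sineVec N) l =
        (2 + 2 * Real.cos (2 * (Real.pi / (N + 2)))) *
          ∑ l ∈ Finset.range (N / 2 + 1), x l * sineVec N l := by
      rw [Finset.mul_sum]
      refine Finset.sum_congr rfl fun l hl => ?_
      rw [Finset.mem_range] at hl
      rw [teleportRow_sineVec hN (by omega)]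
      ring
    rw [e1, e2] at h
    exact mul_right_cancel₀ hpos.ne' h
  have hprop : ∀ l, 2 * l ≤ N → x l = x 0 / sineCoeff N 0 * sineCoeff N l := by
    intro l hl
    have h := teleportRow_eigenvector_unique hN hx0 ha ex
      (fun l hl => by rw [hlameq]; exact teleportRow_sineVec hN hl) l hl
    rw [sineVec_of_le hl, sineVec_of_le (by omega)] at h
    have h0 : 0 < sineCoeff N 0 := sineCoeff_pos (by omega)
    field_simp
    linarith
  set c := x 0 / sineCoeff N 0 with hc
  have hc0 : 0 ≤ c := div_nonneg (hxn 0) (sineCoeff_pos (by omega)).le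
  have hcs : c ^ 2 * ∑ l ∈ Finset.range (N / 2 + 1), sineCoeff N l ^ 2 = 1 := by
    rw [← hsq, Finset.mul_sum]
    refine Finset.sum_congr rfl fun l hl => ?_
    rw [Finset.mem_range] at hl
    rw [hprop l (by omega), mul_pow]
  have hcr : c * √(∑ l ∈ Finset.range (N / 2 + 1), sineCoeff N l ^ 2) = 1 := by
    rw [← Real.sqrt_one, ← hcs, Real.sqrt_mul (sq_nonneg c), Real.sqrt_sq hc0]
  rw [hxv, hprop l hl, qubitCoeff_eq hN hl, eq_div_iff (right_ne_zero_of_mul_eq_one hcr)]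
  linear_combination sineCoeff N l * hcr

/-! ### Ballot numbers -/

/-- The number of standard Young tableaux of shape `(N - l, l)`. -/
def ballot : ℕ → ℕ → ℕ
  | _, 0 => 1
  | 0, _ + 1 => 0
  | N + 1, l + 1 => if 2 * (l + 1) ≤ N + 1 then ballot N (l + 1) + ballot N l else 0

/-- The range reaches one step past the frames, to `2l = N + 1`, where both sides vanish: the
recursion calls this case. -/
theorem ballot_mul (N l : ℕ) (hl : 2 * l ≤ N + 1) :
    ((N : ℝ) + 1) * ballot N l = ((N : ℝ) + 1 - 2 * l) * (N + 1).choose l := by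
  induction N generalizing l with
  | zero =>
    obtain rfl : l = 0 := by omega
    simp [ballot]
  | succ N ih =>
    rcases l with _ | l
    · simp [ballot]
    · rw [ballot]
      split_ifs with h
      · have h1 := ih (l + 1) h
        have h2 := ih l (by omega)
        have h3 : ((N + 1).choose (l + 1) : ℝ) * (l + 1) = (N + 1).choose l * (N + 1 - l) := by
          have := Nat.choose_succ_right_eq (N + 1) l
          have hc : ((N + 1 - l : ℕ) : ℝ) = N + 1 - l := by
            rw [Nat.cast_sub (by omega)]; push_cast; ring
          rw [← hc]
          exact_mod_cast this
        rw [Nat.choose_succ_succ' (N + 1) l]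
        push_cast at h1 h2 ⊢
        have hN : ((N : ℝ) + 1) ≠ 0 := by positivity
        refine mul_left_cancel₀ hN ?_
        linear_combination ((N : ℝ) + 2) * (h1 + h2) - 2 * h3
      · have h2 : (2 * (l + 1) : ℝ) = N + 1 + 1 := by
          exact_mod_cast (by omega : 2 * (l + 1) = N + 1 + 1)
        push_cast
        rw [h2]
        ring

/-! ### Functions on binary words -/

/-- The value of a letter of a binary word as a complex number. -/
def bit (x : Fin 2) : ℂ := (x.val : ℂ)

@[simp] theorem bit_zero : bit 0 = 0 := by simp [bit]

@[simp] theorem bit_one : bit 1 = 1 := by simp [bit]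

/-- The product of singlets on the pairs of letters given by `s`, with the letter `0` at the
remaining places. -/
def pairFun {N l : ℕ} (s : Fin 2 × Fin l ↪ Fin N) (w : Fin N → Fin 2) : ℂ :=
  (∏ i, (bit (w (s (1, i))) - bit (w (s (0, i))))) *
    ∏ c ∈ (Finset.univ.map s)ᶜ, (1 - bit (w c))

/-- The span of the functions `pairFun`. -/
def pairSpan (N l : ℕ) : Submodule ℂ ((Fin N → Fin 2) → ℂ) :=
  Submodule.span ℂ (Set.range (pairFun (N := N) (l := l)))

/-- Functions on words with `l` ones that are orthogonal to all monomials in fewer than `l`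
letters. -/
def highestWeight (N l : ℕ) : Submodule ℂ ((Fin N → Fin 2) → ℂ) where
  carrier := {f | (∀ w, ∑ i, (w i).val ≠ l → f w = 0) ∧
    ∀ A : Finset (Fin N), A.card < l → ∑ w, f w * ∏ i ∈ A, bit (w i) = 0}
  zero_mem' := by simp
  add_mem' := by
    rintro f g ⟨hf, hf'⟩ ⟨hg, hg'⟩
    refine ⟨fun w hw => by simp [hf w hw, hg w hw], fun A hA => ?_⟩
    simp [add_mul, Finset.sum_add_distrib, hf' A hA, hg' A hA]
  smul_mem' := by
    rintro c f ⟨hf, hf'⟩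
    refine ⟨fun w hw => by simp [hf w hw], fun A hA => ?_⟩
    simp only [Pi.smul_apply, smul_eq_mul, mul_assoc, ← Finset.mul_sum, hf' A hA, mul_zero]

theorem sum_val_eq_of_pairFun_ne_zero {N l : ℕ} {s : Fin 2 × Fin l ↪ Fin N} {w : Fin N → Fin 2}
    (h : pairFun s w ≠ 0) : ∑ i, (w i).val = l := by
  obtain ⟨h1, h2⟩ := mul_ne_zero_iff.1 h
  rw [Finset.prod_ne_zero_iff] at h1 h2
  have h3 : ∑ c ∈ (Finset.univ.map s)ᶜ, (w c).val = 0 := by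
    refine Finset.sum_eq_zero fun c hc => ?_
    have := h2 c hc
    generalize w c = x at this ⊢
    fin_cases x <;> simp_all
  rw [← Finset.sum_add_sum_compl (Finset.univ.map s), h3, Finset.sum_map, Fintype.sum_prod_type,
    Fin.sum_univ_two, ← Finset.sum_add_distrib, add_zero]
  rw [Finset.sum_congr rfl (g := fun _ => 1), Finset.sum_const, Finset.card_univ, Fintype.card_fin,
    smul_eq_mul, mul_one]
  intro i hi
  have := h1 i hi
  generalize w (s (0, i)) = x at this ⊢
  generalize w (s (1, i)) = y at this ⊢
  fin_cases x <;> fin_cases y <;> simp_all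

theorem pairFun_comp_swap {N l : ℕ} (s : Fin 2 × Fin l ↪ Fin N) (i : Fin l) (w : Fin N → Fin 2) :
    pairFun s (w ∘ Equiv.swap (s (0, i)) (s (1, i))) = -pairFun s w := by
  unfold pairFun
  rw [← neg_mul]
  congr 1
  · have h : ∀ j, bit ((w ∘ Equiv.swap (s (0, i)) (s (1, i))) (s (1, j))) -
        bit ((w ∘ Equiv.swap (s (0, i)) (s (1, i))) (s (0, j))) =
        (if j = i then -1 else 1) * (bit (w (s (1, j))) - bit (w (s (0, j)))) := by
      intro j
      split_ifs with hj
      · subst hj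
        simp
      · have e (r : Fin 2) : Equiv.swap (s (0, i)) (s (1, i)) (s (r, j)) = s (r, j) := by
          apply Equiv.swap_apply_of_ne_of_ne <;>
          · intro h
            exact hj (congrArg Prod.snd (s.injective h))
        simp [e]
    rw [Finset.prod_congr rfl fun j _ => h j, Finset.prod_mul_distrib, Finset.prod_ite_eq']
    simp
  · refine Finset.prod_congr rfl fun c hc => ?_
    have hc' : ∀ x, s x ≠ c := by simpa using hc
    rw [Function.comp_apply, Equiv.swap_apply_of_ne_of_ne (hc' _).symm (hc' _).symm]

/-- Fewer than `l` letters miss one of the `l` pairs entirely. Swapping that pair fixes the monomial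
and negates the function, so the sum equals its own negative. -/
theorem pairFun_mem_highestWeight {N l : ℕ} (s : Fin 2 × Fin l ↪ Fin N) :
    pairFun s ∈ highestWeight N l := by
  refine ⟨fun w hw => by_contra fun h => hw (sum_val_eq_of_pairFun_ne_zero h), fun A hA => ?_⟩
  obtain ⟨i, hi⟩ : ∃ i, ∀ r, s (r, i) ∉ A := by
    by_contra! h
    choose r hr using h
    refine hA.not_ge ?_
    rw [← Fintype.card_fin l, ← Finset.card_univ]
    refine Finset.card_le_card_of_injOn (fun i => s (r i, i)) (fun i _ => hr i) ?_
    intro i _ j _ h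
    exact congrArg Prod.snd (s.injective h)
  set τ := Equiv.swap (s (0, i)) (s (1, i)) with hτ
  have hneg : ∑ w, pairFun s w * ∏ i ∈ A, bit (w i) =
      -∑ w, pairFun s w * ∏ i ∈ A, bit (w i) := by
    rw [← Finset.sum_neg_distrib]
    refine Fintype.sum_equiv (Equiv.arrowCongr τ (Equiv.refl _)) _ _ fun w => ?_
    have e : (Equiv.arrowCongr τ (Equiv.refl (Fin 2))) w = w ∘ τ := by
      funext x; simp [hτ]
    rw [e, pairFun_comp_swap, neg_mul, neg_neg]
    congr 1
    refine Finset.prod_congr rfl fun c hc => ?_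
    rw [Function.comp_apply, Equiv.swap_apply_of_ne_of_ne]
    · rintro rfl; exact hi _ hc
    · rintro rfl; exact hi _ hc
  linear_combination hneg / 2

theorem pairSpan_le_highestWeight (N l : ℕ) : pairSpan N l ≤ highestWeight N l :=
  Submodule.span_le.2 (by rintro _ ⟨s, rfl⟩; exact pairFun_mem_highestWeight s)

/-- Prescribing the first letter of a word. -/
def consRestrict (N : ℕ) (x : Fin 2) :
    ((Fin (N + 1) → Fin 2) → ℂ) →ₗ[ℂ] ((Fin N → Fin 2) → ℂ) :=
  LinearMap.funLeft ℂ ℂ (fun u => Fin.cons x u)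

@[simp] theorem consRestrict_apply {N : ℕ} (x : Fin 2) (f : (Fin (N + 1) → Fin 2) → ℂ)
    (u : Fin N → Fin 2) : consRestrict N x f u = f (Fin.cons x u) := rfl

theorem sum_words_succ {N : ℕ} (g : (Fin (N + 1) → Fin 2) → ℂ) :
    ∑ w, g w = ∑ u : Fin N → Fin 2, g (Fin.cons 0 u) + ∑ u : Fin N → Fin 2, g (Fin.cons 1 u) := by
  rw [← (Fin.consEquiv (fun _ => Fin 2)).sum_comp, Fintype.sum_prod_type, Fin.sum_univ_two]
  rfl

theorem finrank_map_add_finrank_inf_ker {K V W : Type*} [Field K] [AddCommGroup V] [Module K V]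
    [AddCommGroup W] [Module K W] (f : V →ₗ[K] W) (S : Submodule K V) [FiniteDimensional K S] :
    Module.finrank K (S.map f) + Module.finrank K (S ⊓ LinearMap.ker f : Submodule K V) =
      Module.finrank K S := by
  rw [← LinearMap.finrank_range_add_finrank_ker (f.domRestrict S), LinearMap.range_domRestrict,
    LinearMap.ker_domRestrict, (Submodule.equivSubtypeMap S _).finrank_eq,
    Submodule.map_comap_subtype]

theorem consRestrict_one_mem_highestWeight {N l : ℕ} {f : (Fin (N + 1) → Fin 2) → ℂ}
    (hf : f ∈ highestWeight (N + 1) (l + 1)) : consRestrict N 1 f ∈ highestWeight N l := by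
  obtain ⟨h1, h2⟩ := hf
  refine ⟨fun u hu => h1 _ ?_, fun A hA => ?_⟩
  · rw [Fin.sum_univ_succ]
    simp
    omega
  -- Including the first letter in the monomial kills all words that begin with 0.
  · have := h2 (Finset.cons 0 (A.map (Fin.succEmb N)) (by simp [Fin.succ_ne_zero])) (by
      simpa using hA)
    rw [sum_words_succ] at this
    simpa [Finset.prod_cons, Finset.prod_map] using this

theorem consRestrict_zero_mem_highestWeight {N l : ℕ} {f : (Fin (N + 1) → Fin 2) → ℂ}
    (hf : f ∈ highestWeight (N + 1) l) (h0 : consRestrict N 1 f = 0) :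
    consRestrict N 0 f ∈ highestWeight N l := by
  obtain ⟨h1, h2⟩ := hf
  refine ⟨fun u hu => h1 _ ?_, fun A hA => ?_⟩
  · rw [Fin.sum_univ_succ]
    simpa using hu
  · have := h2 (A.map (Fin.succEmb N)) (by simpa using hA)
    rw [sum_words_succ] at this
    have h0' : ∀ u, f (Fin.cons 1 u) = 0 := fun u => congrFun h0 u
    simpa [h0', Finset.prod_map] using this

/-- A word `v` with `l` ones has `N - l < l` zeros. The product of `1 - bit (w i)` over these zeros
expands into monomials of degree below `l`, yet among words with `l` ones it is nonzero only at `v`.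
Orthogonality thus gives `f v = 0`. -/
theorem highestWeight_eq_bot {N l : ℕ} (h : N < 2 * l) : highestWeight N l = ⊥ := by
  rw [eq_bot_iff]
  rintro f ⟨h1, h2⟩
  rw [Submodule.mem_bot]
  funext v
  by_contra hv
  have hw : ∑ i, (v i).val = l := by_contra fun h => hv (h1 v h)
  have hval (x : Fin 2) : x.val = if x = 0 then 0 else 1 := by fin_cases x <;> simp
  set B : Finset (Fin N) := Finset.univ.filter fun i => v i = 0 with hB
  have hcard : B.card < l := by
    have h3 := Finset.card_filter_add_card_filter_not (s := (Finset.univ : Finset (Fin N)))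
      (fun i => v i = 0)
    have h4 : (Finset.univ.filter fun i => ¬ v i = 0).card = l := by
      rw [← hw, Finset.card_filter]
      refine Finset.sum_congr rfl fun i _ => ?_
      rw [hval, ite_not]
    rw [Finset.card_univ, Fintype.card_fin, h4, ← hB] at h3
    omega
  have hsum : ∑ w, f w * ∏ i ∈ B, (1 - bit (w i)) = 0 := by
    simp only [sub_eq_add_neg, Finset.prod_one_add, Finset.prod_neg, Finset.mul_sum]
    rw [Finset.sum_comm]
    refine Finset.sum_eq_zero fun C hC => ?_
    have hC' := h2 C ((Finset.card_le_card (Finset.mem_powerset.1 hC)).trans_lt hcard)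
    rw [Finset.sum_congr rfl fun w _ => mul_left_comm (f w) _ _, ← Finset.mul_sum, hC', mul_zero]
  rw [Finset.sum_eq_single v] at hsum
  · rw [Finset.prod_eq_one, mul_one] at hsum
    · exact hv hsum
    · intro i hi
      rw [hB, Finset.mem_filter] at hi
      simp [hi.2]
  · intro w _ hwv
    by_contra hne
    obtain ⟨hfw, hp⟩ := mul_ne_zero_iff.1 hne
    rw [Finset.prod_ne_zero_iff] at hp
    have hle : ∀ i ∈ Finset.univ, (w i).val ≤ (v i).val := by
      intro i _
      by_cases hi : v i = 0
      · have := hp i (by simp [hB, hi])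
        rw [hi]
        generalize w i = x at this
        fin_cases x <;> simp_all
      · rw [hval (v i), if_neg hi]
        omega
    have hsw : ∑ i, (w i).val = l := by_contra fun h => hfw (h1 w h)
    have heq := (Finset.sum_eq_sum_iff_of_le hle).1 (hsw.trans hw.symm)
    exact hwv (funext fun i => Fin.ext (heq i (Finset.mem_univ i)))
  · simp

/-- Rank-nullity for fixing the first letter to 1: the image lies in the space for `(N, l)`, and the
kernel embeds into that for `(N, l + 1)`, matching the ballot recursion. -/
theorem finrank_highestWeight_le (N l : ℕ) :
    Module.finrank ℂ (highestWeight N l) ≤ ballot N l := by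
  induction N generalizing l with
  | zero =>
    rcases l with _ | l
    · refine (Submodule.finrank_le _).trans ?_
      simp [ballot]
    · rw [highestWeight_eq_bot (by omega)]; simp
  | succ N ih =>
    rcases l with _ | l
    · have hinj : Function.Injective
          ((LinearMap.proj (0 : Fin (N + 1) → Fin 2) : _ →ₗ[ℂ] ℂ).domRestrict
            (highestWeight (N + 1) 0)) := by
        rw [← LinearMap.ker_eq_bot, LinearMap.ker_eq_bot']
        rintro ⟨f, h1, _⟩ h0
        refine Subtype.ext (funext fun w => ?_)
        by_cases hw : w = 0
        · subst hw; exact h0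
        · refine h1 w ?_
          obtain ⟨i, hi⟩ := Function.ne_iff.1 hw
          intro hs
          exact hi (Fin.ext ((Finset.sum_eq_zero_iff.1 hs) i (Finset.mem_univ i)))
      refine (LinearMap.finrank_le_finrank_of_injective hinj).trans ?_
      simp [ballot]
    · rw [ballot]
      split_ifs with h
      · rw [← finrank_map_add_finrank_inf_ker (consRestrict N 1), add_comm]
        refine add_le_add ?_ ?_
        · refine le_trans ?_ (ih (l + 1))
          refine LinearMap.finrank_le_finrank_of_injective
            (f := (consRestrict N 0).restrict (p := highestWeight (N + 1) (l + 1) ⊓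
              LinearMap.ker (consRestrict N 1)) (q := highestWeight N (l + 1))
              fun f hf => consRestrict_zero_mem_highestWeight hf.1 hf.2) ?_
          rw [← LinearMap.ker_eq_bot, LinearMap.ker_eq_bot']
          rintro ⟨f, hf, hf1⟩ h00
          refine Subtype.ext (funext fun w => ?_)
          have h0' := congrArg Subtype.val h00
          rw [← Fin.cons_self_tail w]
          generalize w 0 = x
          fin_cases x
          · exact congrFun h0' (Fin.tail w)
          · exact congrFun hf1 (Fin.tail w)
        · refine le_trans (Submodule.finrank_mono ?_) (ih l)
          rintro _ ⟨f, hf, rfl⟩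
          exact consRestrict_one_mem_highestWeight hf
      · rw [highestWeight_eq_bot (by omega)]; simp

/-- Extending a function by zero to words whose first letter is not `0`. -/
def consExtend (N : ℕ) : ((Fin N → Fin 2) → ℂ) →ₗ[ℂ] ((Fin (N + 1) → Fin 2) → ℂ) where
  toFun f w := (1 - bit (w 0)) * f (Fin.tail w)
  map_add' f g := by funext w; simp [mul_add]
  map_smul' c f := by funext w; simp [mul_left_comm]

theorem consExtend_apply {N : ℕ} (f : (Fin N → Fin 2) → ℂ) (w : Fin (N + 1) → Fin 2) :
    consExtend N f w = (1 - bit (w 0)) * f (Fin.tail w) := rfl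

theorem consExtend_pairFun {N l : ℕ} (s : Fin 2 × Fin l ↪ Fin N) :
    consExtend N (pairFun s) = pairFun (s.trans (Fin.succEmb N)) := by
  funext w
  have hcompl : (Finset.univ.map (s.trans (Fin.succEmb N)))ᶜ =
      Finset.cons 0 ((Finset.univ.map s)ᶜ.map (Fin.succEmb N)) (by simp [Fin.succ_ne_zero]) := by
    ext c
    refine Fin.cases ?_ (fun c => ?_) c
    · simp [Fin.succ_ne_zero]
    · simp [Fin.succ_ne_zero]
  rw [consExtend_apply, pairFun, pairFun, hcompl, Finset.prod_cons, Finset.prod_map]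
  simp only [Fin.tail, Function.Embedding.trans_apply, Fin.coe_succEmb]
  ring

/-- Adding the pair that consists of the new first place and the place `c`. -/
def addPair {N l : ℕ} (s : Fin 2 × Fin l ↪ Fin N) (c : Fin N) (hc : ∀ x, s x ≠ c) :
    Fin 2 × Fin (l + 1) ↪ Fin (N + 1) where
  toFun x := Fin.cases (if x.1 = 0 then c.succ else 0) (fun i => (s (x.1, i)).succ) x.2
  inj' := by
    rintro ⟨r, i⟩ ⟨q, j⟩
    refine Fin.cases ?_ (fun i => ?_) i <;> refine Fin.cases ?_ (fun j => ?_) j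
    · fin_cases r <;> fin_cases q <;> simp [Fin.succ_ne_zero, (Fin.succ_ne_zero _).symm]
    · fin_cases r <;> simp [(hc _).symm, (Fin.succ_ne_zero _).symm]
    · fin_cases q <;> simp [hc, Fin.succ_ne_zero]
    · simp

section AddPair

variable {N l : ℕ} (s : Fin 2 × Fin l ↪ Fin N) (c : Fin N) (hc : ∀ x, s x ≠ c)

@[simp] theorem addPair_zero_zero : addPair s c hc (0, 0) = c.succ := rfl

@[simp] theorem addPair_one_zero : addPair s c hc (1, 0) = 0 := rfl

@[simp] theorem addPair_succ (r : Fin 2) (i : Fin l) :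
    addPair s c hc (r, i.succ) = (s (r, i)).succ := rfl

theorem compl_map_addPair : (Finset.univ.map (addPair s c hc))ᶜ =
    ((Finset.univ.map s)ᶜ.erase c).map (Fin.succEmb N) := by
  have hmem (d : Fin (N + 1)) :
      (∃ x, addPair s c hc x = d) ↔ c.succ = d ∨ 0 = d ∨ ∃ x, (s x).succ = d := by
    constructor
    · rintro ⟨⟨r, i⟩, rfl⟩
      refine Fin.cases ?_ (fun i => ?_) i
      · fin_cases r
        · exact Or.inl rfl
        · exact Or.inr (Or.inl rfl)
      · exact Or.inr (Or.inr ⟨_, rfl⟩)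
    · rintro (rfl | rfl | ⟨⟨r, i⟩, rfl⟩)
      · exact ⟨(0, 0), rfl⟩
      · exact ⟨(1, 0), rfl⟩
      · exact ⟨(r, i.succ), rfl⟩
  ext d
  rw [Finset.mem_compl, Finset.mem_map]
  simp only [Finset.mem_univ, true_and, hmem]
  refine Fin.cases ?_ (fun d => ?_) d
  · simp [Fin.succ_ne_zero]
  · have h0 : ¬ (0 = d.succ) := (Fin.succ_ne_zero d).symm
    simp only [h0, false_or, Fin.succ_inj, Finset.mem_map, Finset.mem_erase, Finset.mem_compl,
      Finset.mem_univ, true_and, Fin.coe_succEmb, exists_eq_right, not_or, ne_eq,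
      eq_comm (a := c)]

/-- At first letter 1 the new singlet factor becomes `1 - bit (u c)`, exactly the factor that the
free place `c` contributed before. -/
theorem consRestrict_pairFun_addPair :
    consRestrict N 1 (pairFun (addPair s c hc)) = pairFun s := by
  funext u
  have hcm : c ∈ (Finset.univ.map s)ᶜ := by simpa using hc
  rw [consRestrict_apply, pairFun, pairFun, compl_map_addPair, Finset.prod_map,
    Fin.prod_univ_succ, ← Finset.mul_prod_erase _ _ hcm]
  simp only [addPair_zero_zero, addPair_one_zero, addPair_succ, Fin.cons_zero, Fin.cons_succ,
    Fin.coe_succEmb, bit_one]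
  ring

end AddPair

theorem consRestrict_one_consExtend {N : ℕ} (f : (Fin N → Fin 2) → ℂ) :
    consRestrict N 1 (consExtend N f) = 0 := by
  funext u; simp [consExtend_apply]

theorem consRestrict_zero_consExtend {N : ℕ} (f : (Fin N → Fin 2) → ℂ) :
    consRestrict N 0 (consExtend N f) = f := by
  funext u; simp [consExtend_apply]

theorem one_le_finrank_pairSpan_zero (N : ℕ) : 1 ≤ Module.finrank ℂ (pairSpan N 0) := by
  rw [Nat.one_le_iff_ne_zero, Submodule.finrank_eq_zero.ne, Submodule.ne_bot_iff]
  let s : Fin 2 × Fin 0 ↪ Fin N := Function.Embedding.ofIsEmpty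
  refine ⟨pairFun s, Submodule.subset_span ⟨s, rfl⟩, fun h => ?_⟩
  have := congrFun h 0
  simp [pairFun] at this

/-- The same split with reversed inclusions: adding a pair shows that the image contains the span
for `(N, l)`, and extension by zero embeds the span for `(N, l + 1)` into the kernel. -/
theorem ballot_le_finrank_pairSpan (N l : ℕ) :
    ballot N l ≤ Module.finrank ℂ (pairSpan N l) := by
  induction N generalizing l with
  | zero =>
    rcases l with _ | l
    · simpa [ballot] using one_le_finrank_pairSpan_zero 0
    · simp [ballot]
  | succ N ih =>
    rcases l with _ | l
    · simpa [ballot] using one_le_finrank_pairSpan_zero (N + 1)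
    · rw [ballot]
      split_ifs with h
      · rw [← finrank_map_add_finrank_inf_ker (consRestrict N 1), add_comm]
        refine add_le_add ((ih l).trans (Submodule.finrank_mono ?_)) ((ih (l + 1)).trans ?_)
        · refine Submodule.span_le.2 ?_
          rintro _ ⟨s, rfl⟩
          -- A free place exists because `2(l + 1) ≤ N + 1` gives `2l < N`.
          obtain ⟨c, hc⟩ : ∃ c, ∀ x, s x ≠ c := by
            by_contra! hs
            have := Fintype.card_le_of_surjective s hs
            simp at this
            omega
          exact ⟨_, Submodule.subset_span ⟨addPair s c hc, rfl⟩,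
            consRestrict_pairFun_addPair s c hc⟩
        · refine LinearMap.finrank_le_finrank_of_injective
            (f := (consExtend N).restrict (p := pairSpan N (l + 1))
              (q := pairSpan (N + 1) (l + 1) ⊓ LinearMap.ker (consRestrict N 1)) ?_) ?_
          · intro f hf
            refine ⟨?_, consRestrict_one_consExtend f⟩
            suffices pairSpan N (l + 1) ≤ (pairSpan (N + 1) (l + 1)).comap (consExtend N) from
              this hf
            refine Submodule.span_le.2 ?_
            rintro _ ⟨s, rfl⟩
            exact Submodule.subset_span ⟨_, (consExtend_pairFun s).symm⟩
          · intro f g hfg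
            have h1 : consExtend N f = consExtend N g := congrArg Subtype.val hfg
            refine Subtype.ext ?_
            rw [← consRestrict_zero_consExtend f.1, h1, consRestrict_zero_consExtend]
      · exact Nat.zero_le _

theorem finrank_pairSpan (N l : ℕ) : Module.finrank ℂ (pairSpan N l) = ballot N l :=
  le_antisymm ((Submodule.finrank_mono (pairSpan_le_highestWeight N l)).trans
    (finrank_highestWeight_le N l)) (ballot_le_finrank_pairSpan N l)

/-! ### Specht modules of two-row frames -/

/-- The boxes of `(N - l, l)`: the columns of length two, and the remaining boxes of the first
row. -/
def cellEquiv (N l : ℕ) (hl : 2 * l ≤ N) :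
    (Fin 2 × Fin l) ⊕ Fin (N - 2 * l) ≃ (diagram (twoRow N l hl).1).cells :=
  Equiv.ofBijective
    (Sum.elim
      (fun x => ⟨(x.1.val, x.2.val), by
        rw [YoungDiagram.mem_cells, mem_diagram_twoRow]
        dsimp only
        omega⟩)
      (fun c => ⟨(0, l + c.val), by
        rw [YoungDiagram.mem_cells, mem_diagram_twoRow]
        dsimp only
        omega⟩))
    ⟨by
      rintro (⟨r, i⟩ | c) (⟨q, j⟩ | d) h <;>
        simp only [Sum.elim_inl, Sum.elim_inr, Subtype.mk.injEq, Prod.mk.injEq] at h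
      · rw [Fin.ext h.1, Fin.ext h.2]
      · omega
      · omega
      · rw [Fin.ext (by omega : c.val = d.val)],
    by
      rintro ⟨⟨i, j⟩, h⟩
      have h' := h
      rw [YoungDiagram.mem_cells, mem_diagram_twoRow] at h'
      dsimp only at h'
      by_cases hj : j < l
      · exact ⟨Sum.inl (⟨i, by omega⟩, ⟨j, hj⟩), rfl⟩
      · refine ⟨Sum.inr ⟨j - l, by omega⟩, Subtype.ext (Prod.ext ?_ ?_)⟩
        · simp only [Sum.elim_inr]; omega
        · simp only [Sum.elim_inr]; omega⟩

@[simp] theorem cellEquiv_inl {N l : ℕ} (hl : 2 * l ≤ N) (x : Fin 2 × Fin l) :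
    (cellEquiv N l hl (Sum.inl x)).1 = (x.1.val, x.2.val) := rfl

@[simp] theorem cellEquiv_inr {N l : ℕ} (hl : 2 * l ≤ N) (c : Fin (N - 2 * l)) :
    (cellEquiv N l hl (Sum.inr c)).1 = (0, l + c.val) := rfl

/-- The Leibniz expansion: the entry conditions retain the column-preserving permutations that carry
the row word of `t` to `w`. As a determinant the value factors over columns. -/
theorem polytabloid_apply {N : ℕ} {μ : N.Partition} (t : Tableau μ) (w : Fin N → ℕ) :
    polytabloid t w = (Matrix.of fun i j : Fin N =>
      if (t i).1.2 = (t j).1.2 ∧ w i = (t j).1.1 then (1 : ℂ) else 0).det := by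
  rw [Matrix.det_apply', polytabloid, Finset.sum_apply, Finset.sum_filter]
  refine Finset.sum_congr rfl fun σ _ => ?_
  simp only [Matrix.of_apply, Pi.smul_apply, permRep_single, smul_eq_mul, Pi.single_apply]
  have hprod : ∏ i, (if (t (σ i)).1.2 = (t i).1.2 ∧ w (σ i) = (t i).1.1 then (1 : ℂ) else 0) =
      if ∀ i, (t (σ i)).1.2 = (t i).1.2 ∧ w (σ i) = (t i).1.1 then 1 else 0 := by
    rw [Finset.prod_ite_zero]
    simp
  have hw : w = (fun i => (t i).1.1) ∘ σ.symm ↔ ∀ i, w (σ i) = (t i).1.1 := by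
    constructor
    · rintro h i; rw [h]; simp
    · intro h; funext i; simp [← h]
  rw [hprod]
  simp only [hw, forall_and]
  split_ifs <;> simp_all

theorem polytabloid_eq_zero {N : ℕ} {μ : N.Partition} (t : Tableau μ) {w : Fin N → ℕ} {i : Fin N}
    (hi : ∀ j, w i ≠ (t j).1.1) : polytabloid t w = 0 := by
  rw [polytabloid_apply]
  refine Matrix.det_eq_zero_of_row_eq_zero i fun j => ?_
  simp [hi j]

/-- The columns of length two of a tableau of shape `(N - l, l)`. -/
def pairEmb {N l : ℕ} {hl : 2 * l ≤ N} (t : Tableau (twoRow N l hl).1) : Fin 2 × Fin l ↪ Fin N :=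
  Function.Embedding.inl.trans ((cellEquiv N l hl).trans t.symm).toEmbedding

theorem pairEmb_apply {N l : ℕ} {hl : 2 * l ≤ N} (t : Tableau (twoRow N l hl).1)
    (x : Fin 2 × Fin l) : pairEmb t x = t.symm (cellEquiv N l hl (Sum.inl x)) := rfl

theorem prod_compl_map_pairEmb {N l : ℕ} {hl : 2 * l ≤ N} (t : Tableau (twoRow N l hl).1)
    (f : Fin N → ℂ) :
    ∏ c ∈ (Finset.univ.map (pairEmb t))ᶜ, f c =
      ∏ c : Fin (N - 2 * l), f (t.symm (cellEquiv N l hl (Sum.inr c))) := by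
  have : (Finset.univ.map (pairEmb t))ᶜ = Finset.univ.map
      (Function.Embedding.inr.trans ((cellEquiv N l hl).trans t.symm).toEmbedding) := by
    ext c
    obtain ⟨x, rfl⟩ := ((cellEquiv N l hl).trans t.symm).surjective c
    rcases x with x | x <;> simp [pairEmb_apply]
  rw [this, Finset.prod_map]
  rfl

theorem polytabloid_val {N l : ℕ} {hl : 2 * l ≤ N} (t : Tableau (twoRow N l hl).1)
    (w : Fin N → Fin 2) : polytabloid t (fun i => (w i).val) = pairFun (pairEmb t) w := by
  rw [polytabloid_apply, ← Matrix.det_submatrix_equiv_self ((cellEquiv N l hl).trans t.symm),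
    pairFun, prod_compl_map_pairEmb]
  set e := (cellEquiv N l hl).trans t.symm with he
  have hblocks : (Matrix.of fun i j : Fin N =>
      if (t i).1.2 = (t j).1.2 ∧ (w i).val = (t j).1.1 then (1 : ℂ) else 0).submatrix e e =
      Matrix.fromBlocks
        (Matrix.blockDiagonal fun i : Fin l => Matrix.of fun r q : Fin 2 =>
          if w (e (Sum.inl (r, i))) = q then (1 : ℂ) else 0) 0 0
        (Matrix.diagonal fun c => if w (e (Sum.inr c)) = 0 then (1 : ℂ) else 0) := by
    ext (⟨r, i⟩ | c) (⟨q, j⟩ | d)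
    · by_cases hij : i = j
      · subst hij; simp [e, Matrix.blockDiagonal_apply, Fin.val_inj]; congr
      · simp [e, Matrix.blockDiagonal_apply, hij, Fin.val_inj]
    · simp [e]; omega
    · simp [e]; omega
    · by_cases hcd : c = d
      · subst hcd; simp [e]; congr
      · simp [e, hcd, Fin.val_inj]
  rw [hblocks, Matrix.det_fromBlocks_zero₂₁, Matrix.det_blockDiagonal, Matrix.det_diagonal]
  congr 1
  · refine Finset.prod_congr rfl fun i _ => ?_
    rw [Matrix.det_fin_two]
    simp only [Matrix.of_apply]
    change _ = bit (w (e (Sum.inl (1, i)))) - bit (w (e (Sum.inl (0, i))))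
    generalize w (e (Sum.inl (1, i))) = x
    generalize w (e (Sum.inl (0, i))) = y
    fin_cases x <;> fin_cases y <;> simp
  · refine Finset.prod_congr rfl fun c _ => ?_
    change _ = 1 - bit (w (e (Sum.inr c)))
    generalize w (e (Sum.inr c)) = x
    fin_cases x <;> simp

theorem exists_pairEmb_eq {N l : ℕ} (hl : 2 * l ≤ N) (s : Fin 2 × Fin l ↪ Fin N) :
    ∃ t : Tableau (twoRow N l hl).1, pairEmb t = s := by
  classical
  have hcard : Fintype.card ((Set.range s)ᶜ : Set (Fin N)) = N - 2 * l := by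
    rw [Fintype.card_compl_set, Set.card_range_of_injective s.injective]
    simp
  let e : (Fin 2 × Fin l) ⊕ Fin (N - 2 * l) ≃ Fin N :=
    (Equiv.sumCongr (Equiv.ofInjective s s.injective)
      (Fintype.equivFinOfCardEq hcard).symm).trans (Equiv.Set.sumCompl (Set.range s))
  refine ⟨e.symm.trans (cellEquiv N l hl), ?_⟩
  ext x
  simp [pairEmb_apply, e]

/-- Restricting a function on words to binary words. -/
def binaryRestrict (N : ℕ) : ((Fin N → ℕ) → ℂ) →ₗ[ℂ] ((Fin N → Fin 2) → ℂ) :=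
  LinearMap.funLeft ℂ ℂ (fun w i => (w i).val)

theorem binaryRestrict_polytabloid {N l : ℕ} {hl : 2 * l ≤ N} (t : Tableau (twoRow N l hl).1) :
    binaryRestrict N (polytabloid t) = pairFun (pairEmb t) :=
  funext fun w => polytabloid_val t w

theorem map_binaryRestrict_specht {N l : ℕ} (hl : 2 * l ≤ N) :
    (specht (twoRow N l hl).1).toSubmodule.map (binaryRestrict N) = pairSpan N l := by
  rw [specht, pairSpan, Submodule.map_span, ← Set.range_comp]
  congr 1
  ext f
  constructor
  · rintro ⟨t, rfl⟩
    exact ⟨_, (binaryRestrict_polytabloid t).symm⟩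
  · rintro ⟨s, rfl⟩
    obtain ⟨t, rfl⟩ := exists_pairEmb_eq hl s
    exact ⟨t, binaryRestrict_polytabloid t⟩

/-- Polytabloids are supported on words whose letters are row indices, here 0 and 1, so restriction
to binary words loses nothing. -/
theorem eq_zero_of_binaryRestrict_eq_zero {N l : ℕ} {hl : 2 * l ≤ N} {f : (Fin N → ℕ) → ℂ}
    (hf : f ∈ (specht (twoRow N l hl).1).toSubmodule) (h0 : binaryRestrict N f = 0) : f = 0 := by
  have hsupp : ∀ w : Fin N → ℕ, (∃ i, 2 ≤ w i) → f w = 0 := by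
    rintro w ⟨i, hi⟩
    clear h0
    induction hf using Submodule.span_induction with
    | mem f hf =>
      obtain ⟨t, rfl⟩ := hf
      refine polytabloid_eq_zero t (i := i) fun j h => ?_
      have := (t j).2
      rw [YoungDiagram.mem_cells, mem_diagram_twoRow] at this
      omega
    | zero => rfl
    | add f g _ _ hf hg => simp [hf, hg]
    | smul a f _ hf => simp [hf]
  funext w
  by_cases hw : ∃ i, 2 ≤ w i
  · exact hsupp w hw
  · push Not at hw
    exact congrFun h0 fun i => ⟨w i, hw i⟩

theorem dimIrrep_twoRow {N l : ℕ} (hl : 2 * l ≤ N) : dimIrrep (twoRow N l hl).1 = ballot N l := by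
  rw [← finrank_pairSpan, ← map_binaryRestrict_specht hl, dimIrrep]
  rw [← finrank_map_add_finrank_inf_ker (binaryRestrict N)]
  have : (specht (twoRow N l hl).1).toSubmodule ⊓ LinearMap.ker (binaryRestrict N) = ⊥ :=
    eq_bot_iff.2 fun f hf => eq_zero_of_binaryRestrict_eq_zero hf.1 hf.2
  rw [this, finrank_bot, add_zero]

/-! ### Multiplicities of two-row frames -/

@[simp] theorem permRep_apply {N : ℕ} {κ : Type} (σ : Equiv.Perm (Fin N)) (f : (Fin N → κ) → ℂ)
    (w : Fin N → κ) : permRep N κ σ f w = f (w ∘ σ) := rfl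

theorem binaryRestrict_permRep {N : ℕ} (σ : Equiv.Perm (Fin N)) (f : (Fin N → ℕ) → ℂ) :
    binaryRestrict N (permRep N ℕ σ f) = permRep N (Fin 2) σ (binaryRestrict N f) := rfl

/-- Summing a function over all smaller words, on words with `n` ones. -/
def raise (N n : ℕ) : ((Fin N → Fin 2) → ℂ) →ₗ[ℂ] ((Fin N → Fin 2) → ℂ) where
  toFun f w := if ∑ i, (w i).val = n then ∑ u with ∀ i, u i ≤ w i, f u else 0
  map_add' f g := by
    funext w
    simp only [Pi.add_apply, Finset.sum_add_distrib]
    split_ifs <;> simp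
  map_smul' c f := by
    funext w
    simp only [Pi.smul_apply, smul_eq_mul, ← Finset.mul_sum, RingHom.id_apply, mul_ite, mul_zero]

theorem raise_apply {N n : ℕ} (f : (Fin N → Fin 2) → ℂ) (w : Fin N → Fin 2) :
    raise N n f w = if ∑ i, (w i).val = n then ∑ u with ∀ i, u i ≤ w i, f u else 0 := rfl

theorem raise_permRep {N n : ℕ} (σ : Equiv.Perm (Fin N)) (f : (Fin N → Fin 2) → ℂ) :
    raise N n (permRep N (Fin 2) σ f) = permRep N (Fin 2) σ (raise N n f) := by
  funext w
  rw [permRep_apply, raise_apply, raise_apply]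
  have h1 : ∑ i, ((w ∘ σ) i).val = ∑ i, (w i).val := Equiv.sum_comp σ fun i => (w i).val
  rw [h1]
  congr 1
  refine Finset.sum_bij' (fun u _ => u ∘ σ) (fun u _ => u ∘ σ.symm) ?_ ?_ ?_ ?_ ?_
  · intro u hu
    rw [Finset.mem_filter] at hu ⊢
    exact ⟨Finset.mem_univ _, fun i => hu.2 (σ i)⟩
  · intro u hu
    rw [Finset.mem_filter] at hu ⊢
    refine ⟨Finset.mem_univ _, fun i => ?_⟩
    have := hu.2 (σ.symm i)
    simpa using this
  · intro u _; funext i; simp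
  · intro u _; funext i; simp
  · intro u _; rfl

/-- The word with `k` ones followed by zeros. -/
def threshold (m k : ℕ) (c : Fin m) : Fin 2 := if c.val < k then 1 else 0

theorem sum_threshold {m k : ℕ} (hk : k ≤ m) : ∑ c, (threshold m k c).val = k := by
  have h : ∀ c : Fin m, (threshold m k c).val = if c.val < k then 1 else 0 := by
    intro c; unfold threshold; split_ifs <;> rfl
  rw [Finset.sum_congr rfl fun c _ => h c, ← Finset.card_filter, Fin.card_filter_val_lt]
  omega

theorem exists_comp_perm_eq_threshold {m : ℕ} (x : Fin m → Fin 2) :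
    ∃ (k : Fin (m + 1)) (ρ : Equiv.Perm (Fin m)), x ∘ ρ = threshold m k := by
  have hle : Fintype.card {c // x c = 1} ≤ m := by
    simpa using Fintype.card_subtype_le fun c => x c = 1
  let k : Fin (m + 1) := ⟨Fintype.card {c // x c = 1}, by omega⟩
  have hcard : Fintype.card {c : Fin m // c.val < k.val} = Fintype.card {c // x c = 1} := by
    rw [Fintype.card_subtype, Fin.card_filter_val_lt]
    exact min_eq_right hle
  let e := Fintype.equivOfCardEq hcard
  refine ⟨k, e.extendSubtype, funext fun c => ?_⟩
  rw [Function.comp_apply, threshold]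
  split_ifs with h
  · exact e.extendSubtype_mem c h
  · have := e.extendSubtype_not_mem c h
    generalize x (e.extendSubtype c) = y at this ⊢
    fin_cases y <;> simp_all

/-! ### Equivariant maps evaluated at one polytabloid -/

section Evaluation

variable {N l : ℕ} {hl : 2 * l ≤ N} (t : Tableau (twoRow N l hl).1)

/-- The binary word with prescribed letters on the boxes of a tableau. -/
def boxWord (x : Fin (N - 2 * l) → Fin 2) : Fin N → Fin 2 :=
  Sum.elim Prod.fst x ∘ ((cellEquiv N l hl).trans t.symm).symm

/-- The entry of a tableau in a box of a column of length one. -/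
def single (c : Fin (N - 2 * l)) : Fin N := t.symm (cellEquiv N l hl (Sum.inr c))

@[simp] theorem boxWord_pairEmb (x : Fin (N - 2 * l) → Fin 2) (p : Fin 2 × Fin l) :
    boxWord t x (pairEmb t p) = p.1 := by
  simp [boxWord, pairEmb_apply]

@[simp] theorem boxWord_single (x : Fin (N - 2 * l) → Fin 2) (c : Fin (N - 2 * l)) :
    boxWord t x (single t c) = x c := by
  simp [boxWord, single]

theorem eq_pairEmb_or_eq_single (j : Fin N) : (∃ p, j = pairEmb t p) ∨ ∃ c, j = single t c := by
  obtain ⟨x, rfl⟩ := ((cellEquiv N l hl).trans t.symm).surjective j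
  rcases x with p | c
  · exact Or.inl ⟨p, rfl⟩
  · exact Or.inr ⟨c, rfl⟩

theorem eq_boxWord {w : Fin N → Fin 2} (x : Fin (N - 2 * l) → Fin 2)
    (h1 : ∀ p, w (pairEmb t p) = p.1) (h2 : ∀ c, w (single t c) = x c) : w = boxWord t x := by
  funext j
  rcases eq_pairEmb_or_eq_single t j with ⟨p, rfl⟩ | ⟨c, rfl⟩
  · rw [h1, boxWord_pairEmb]
  · rw [h2, boxWord_single]

theorem sum_boxWord (x : Fin (N - 2 * l) → Fin 2) :
    ∑ j, (boxWord t x j).val = l + ∑ c, (x c).val := by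
  rw [← Equiv.sum_comp ((cellEquiv N l hl).trans t.symm), Fintype.sum_sum_type,
    Fintype.sum_prod_type]
  simp [boxWord]

theorem pairFun_pairEmb (w : Fin N → Fin 2) :
    pairFun (pairEmb t) w = (∏ i, (bit (w (pairEmb t (1, i))) - bit (w (pairEmb t (0, i))))) *
      ∏ c, (1 - bit (w (single t c))) := by
  rw [pairFun, prod_compl_map_pairEmb]
  rfl

/-- The bound forces 0 at the top of each long column; a nonzero summand then needs 1 below it and 0
at all single boxes. One word survives, with value 1. -/
theorem sum_pairFun_le_boxWord (x : Fin (N - 2 * l) → Fin 2) :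
    ∑ u with ∀ j, u j ≤ boxWord t x j, pairFun (pairEmb t) u = 1 := by
  rw [Finset.sum_eq_single (boxWord t 0)]
  · rw [pairFun_pairEmb]
    simp
  · intro u hu hne
    rw [Finset.mem_filter] at hu
    by_contra h
    rw [pairFun_pairEmb] at h
    obtain ⟨h1, h2⟩ := mul_ne_zero_iff.1 h
    rw [Finset.prod_ne_zero_iff] at h1 h2
    refine hne (eq_boxWord t 0 ?_ ?_)
    · rintro ⟨r, i⟩
      have h3 := hu.2 (pairEmb t (0, i))
      rw [boxWord_pairEmb] at h3
      have h4 : u (pairEmb t (0, i)) = 0 := by simpa using h3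
      have h5 := h1 i (Finset.mem_univ _)
      rw [h4] at h5
      fin_cases r
      · exact h4
      · refine Fin.eq_one_of_ne_zero _ fun h6 => h5 ?_
        change u (pairEmb t (1, i)) = 0 at h6
        rw [h6, sub_self]
    · intro c
      have h5 := h2 c (Finset.mem_univ _)
      generalize u (single t c) = y at h5
      fin_cases y <;> simp_all
  · intro h
    refine absurd ?_ h
    rw [Finset.mem_filter]
    refine ⟨Finset.mem_univ _, fun j => ?_⟩
    rcases eq_pairEmb_or_eq_single t j with ⟨p, rfl⟩ | ⟨c, rfl⟩
    · simp
    · simp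

/-- The generator of the Specht module given by a tableau. -/
def spechtGen : (specht (twoRow N l hl).1).toSubmodule :=
  ⟨polytabloid t, Submodule.subset_span ⟨t, rfl⟩⟩

theorem specht_ext {f g : (specht (twoRow N l hl).1).toSubmodule}
    (h : binaryRestrict N f.1 = binaryRestrict N g.1) : f = g := by
  refine Subtype.ext (sub_eq_zero.1 (eq_zero_of_binaryRestrict_eq_zero
    (Submodule.sub_mem _ f.2 g.2) ?_))
  rw [map_sub, h, sub_self]

theorem toRepresentation_swap_spechtGen (i : Fin l) :
    (specht (twoRow N l hl).1).toRepresentation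
      (Equiv.swap (pairEmb t (0, i)) (pairEmb t (1, i))) (spechtGen t) = -spechtGen t := by
  refine specht_ext ?_
  change binaryRestrict N (permRep N ℕ _ (polytabloid t)) = binaryRestrict N (-polytabloid t)
  rw [binaryRestrict_permRep, map_neg, binaryRestrict_polytabloid]
  exact funext fun w => pairFun_comp_swap (pairEmb t) i w

/-- The permutation of the entries of a tableau that permutes its columns of length one. -/
def singlePerm (ρ : Equiv.Perm (Fin (N - 2 * l))) : Equiv.Perm (Fin N) :=
  ((cellEquiv N l hl).trans t.symm).permCongr (Equiv.sumCongr 1 ρ)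

@[simp] theorem singlePerm_pairEmb (ρ : Equiv.Perm (Fin (N - 2 * l))) (p : Fin 2 × Fin l) :
    singlePerm t ρ (pairEmb t p) = pairEmb t p := by
  simp [singlePerm, pairEmb_apply, Equiv.permCongr_apply]

@[simp] theorem singlePerm_single (ρ : Equiv.Perm (Fin (N - 2 * l))) (c : Fin (N - 2 * l)) :
    singlePerm t ρ (single t c) = single t (ρ c) := by
  simp [singlePerm, single, Equiv.permCongr_apply]

theorem toRepresentation_singlePerm_spechtGen (ρ : Equiv.Perm (Fin (N - 2 * l))) :
    (specht (twoRow N l hl).1).toRepresentation (singlePerm t ρ) (spechtGen t) =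
      spechtGen t := by
  refine specht_ext ?_
  change binaryRestrict N (permRep N ℕ _ (polytabloid t)) = binaryRestrict N (polytabloid t)
  rw [binaryRestrict_permRep, binaryRestrict_polytabloid]
  funext w
  rw [permRep_apply, pairFun_pairEmb, pairFun_pairEmb]
  simp only [Function.comp_apply, singlePerm_pairEmb, singlePerm_single]
  rw [Equiv.prod_comp ρ fun c => 1 - bit (w (single t c))]

/-- Equal letters in a long column give `g w = -g w`. Otherwise column swaps bring each long column
to 0 above 1, up to sign, and permuting the single boxes sorts the rest into a threshold word. The
induction counts the columns with nonzero top letter. -/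
theorem eq_zero_of_threshold {g : (Fin N → Fin 2) → ℂ}
    (hswap : ∀ i w, g (w ∘ Equiv.swap (pairEmb t (0, i)) (pairEmb t (1, i))) = -g w)
    (hsingle : ∀ ρ w, g (w ∘ singlePerm t ρ) = g w)
    (h0 : ∀ k : Fin (N - 2 * l + 1), g (boxWord t (threshold _ k)) = 0) : g = 0 := by
  funext w
  induction hn : (Finset.univ.filter fun i => w (pairEmb t (0, i)) ≠ 0).card
    using Nat.strong_induction_on generalizing w with
  | _ n ih =>
  have hpi {i j : Fin l} {r : Fin 2} (hij : j ≠ i) :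
      Equiv.swap (pairEmb t (0, i)) (pairEmb t (1, i)) (pairEmb t (r, j)) = pairEmb t (r, j) := by
    apply Equiv.swap_apply_of_ne_of_ne <;>
    · intro h
      exact hij (congrArg Prod.snd ((pairEmb t).injective h))
  by_cases heq : ∃ i, w (pairEmb t (0, i)) = w (pairEmb t (1, i))
  · obtain ⟨i, hi⟩ := heq
    have h1 := hswap i w
    have h2 : w ∘ Equiv.swap (pairEmb t (0, i)) (pairEmb t (1, i)) = w := by
      funext j
      rw [Function.comp_apply, Equiv.swap_apply_def]
      split_ifs with ha hb
      · rw [ha, hi]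
      · rw [hb, hi]
      · rfl
    rw [h2] at h1
    rw [Pi.zero_apply]
    linear_combination h1 / 2
  push Not at heq
  by_cases hbad : ∃ i, w (pairEmb t (0, i)) ≠ 0
  · obtain ⟨i, hi⟩ := hbad
    suffices h : (Finset.univ.filter fun j =>
        (w ∘ Equiv.swap (pairEmb t (0, i)) (pairEmb t (1, i))) (pairEmb t (0, j)) ≠ 0).card < n by
      rw [← neg_neg (g w), ← hswap i w, ih _ h _ rfl, Pi.zero_apply, Pi.zero_apply, neg_zero]
    rw [← hn]
    refine Finset.card_lt_card ⟨fun j hj => ?_, fun hsub => ?_⟩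
    · rw [Finset.mem_filter] at hj ⊢
      refine ⟨Finset.mem_univ _, ?_⟩
      by_cases hij : j = i
      · rw [hij]; exact hi
      · simpa [hpi hij] using hj.2
    · have := hsub (Finset.mem_filter.2 ⟨Finset.mem_univ i, hi⟩)
      rw [Finset.mem_filter] at this
      have h1 : w (pairEmb t (1, i)) ≠ 0 := by simpa using this.2
      exact heq i ((Fin.eq_one_of_ne_zero _ hi).trans (Fin.eq_one_of_ne_zero _ h1).symm)
  · push Not at hbad
    obtain ⟨k, ρ, hρ⟩ := exists_comp_perm_eq_threshold fun c => w (single t c)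
    rw [← hsingle ρ w, Pi.zero_apply, ← h0 k]
    congr 1
    refine eq_boxWord t _ ?_ ?_
    · rintro ⟨r, i⟩
      rw [Function.comp_apply, singlePerm_pairEmb]
      have h2 := heq i
      rw [hbad i] at h2
      fin_cases r
      · exact hbad i
      · exact Fin.eq_one_of_ne_zero _ h2.symm
    · intro c
      rw [← hρ]
      simp

/-- Evaluation of an equivariant map at a generator of the Specht module, on the words
`boxWord t (threshold _ k)`. -/
def evalGen : Representation.IntertwiningMap (specht (twoRow N l hl).1).toRepresentation
    (permRep N (Fin 2)) →ₗ[ℂ] (Fin (N - 2 * l + 1) → ℂ) where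
  toFun F k := F (spechtGen t) (boxWord t (threshold _ k))
  map_add' _ _ := rfl
  map_smul' _ _ := rfl

/-- The column swaps and single-box permutations act on the generator by a sign and trivially, so
its image satisfies `eq_zero_of_threshold`. Any two tableaux differ by a permutation, so vanishing
there spreads to all polytabloids. -/
theorem evalGen_injective : Function.Injective (evalGen t) := by
  rw [← LinearMap.ker_eq_bot, LinearMap.ker_eq_bot']
  intro F hF
  have hgen : F (spechtGen t) = 0 := by
    refine eq_zero_of_threshold t ?_ ?_ fun k => congrFun hF k
    · intro i w
      have := Representation.IntertwiningMap.isIntertwining _ _ F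
        (Equiv.swap (pairEmb t (0, i)) (pairEmb t (1, i))) (spechtGen t)
      rw [toRepresentation_swap_spechtGen, map_neg] at this
      exact (congrFun this w).symm
    · intro ρ w
      have := Representation.IntertwiningMap.isIntertwining _ _ F (singlePerm t ρ) (spechtGen t)
      rw [toRepresentation_singlePerm_spechtGen] at this
      exact (congrFun this w).symm
  refine DFunLike.ext _ _ ?_
  rintro ⟨f, hf⟩
  change F ⟨f, hf⟩ = 0
  induction hf using Submodule.span_induction with
  | mem f hf =>
    obtain ⟨t', rfl⟩ := hf
    let π : Equiv.Perm (Fin N) := t.trans t'.symm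
    have h1 : (specht (twoRow N l hl).1).toRepresentation π (spechtGen t) = spechtGen t' := by
      refine Subtype.ext ?_
      change permRep N ℕ π (polytabloid t) = polytabloid t'
      rw [permRep_polytabloid]
      congr 1
      refine Equiv.ext fun j => ?_
      change t (t.symm (t' j)) = t' j
      rw [Equiv.apply_symm_apply]
    change F (spechtGen t') = 0
    rw [← h1, Representation.IntertwiningMap.isIntertwining _ _ F, hgen, map_zero]
  | zero => exact map_zero F
  | add f g hf hg h1 h2 =>
    exact (map_add F ⟨f, hf⟩ ⟨g, hg⟩).trans (by rw [h1, h2, add_zero])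
  | smul a f hf h1 =>
    exact (map_smul F a ⟨f, hf⟩).trans (by rw [h1, smul_zero])

/-- The equivariant maps from a two-row Specht module to functions on binary words. -/
def raiseIntertwining (hl : 2 * l ≤ N) (n : ℕ) :
    Representation.IntertwiningMap (specht (twoRow N l hl).1).toRepresentation
      (permRep N (Fin 2)) where
  toLinearMap := raise N n ∘ₗ binaryRestrict N ∘ₗ (specht (twoRow N l hl).1).toSubmodule.subtype
  isIntertwining' σ := LinearMap.ext fun f => raise_permRep σ (binaryRestrict N f.1)

/-- The word for `j` has `l + j` ones, so `raise` vanishes there unless `j = k`, and then the sum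
over smaller words is 1. -/
theorem evalGen_raiseIntertwining (k : Fin (N - 2 * l + 1)) :
    evalGen t (raiseIntertwining hl (l + k)) = Pi.single k 1 := by
  funext j
  change raise N (l + k) (binaryRestrict N (polytabloid t)) (boxWord t (threshold _ j)) = _
  rw [raise_apply, binaryRestrict_polytabloid, sum_pairFun_le_boxWord t, sum_boxWord,
    sum_threshold (by omega), Pi.single_apply]
  congr 1
  simp [Fin.ext_iff]

theorem evalGen_surjective : Function.Surjective (evalGen t) := by
  rw [← LinearMap.range_eq_top, eq_top_iff, ← (Pi.basisFun ℂ _).span_eq, Submodule.span_le]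
  rintro _ ⟨k, rfl⟩
  exact ⟨_, (evalGen_raiseIntertwining t k).trans (Pi.basisFun_apply ℂ _ k).symm⟩

end Evaluation

theorem multIrrep_twoRow {N l : ℕ} (hl : 2 * l ≤ N) :
    multIrrep 2 (twoRow N l hl).1 = N - 2 * l + 1 := by
  have hcard : Fintype.card ((Fin 2 × Fin l) ⊕ Fin (N - 2 * l)) = N := by
    simp; omega
  let t : Tableau (twoRow N l hl).1 :=
    (Fintype.equivFinOfCardEq hcard).symm.trans (cellEquiv N l hl)
  rw [multIrrep, (LinearEquiv.ofBijective (evalGen t)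
    ⟨evalGen_injective t, evalGen_surjective t⟩).finrank_eq, Module.finrank_fin_fun]

/-! ### The qubit fidelity -/

theorem sqrt_dimIrrep_mul_multIrrep {N l : ℕ} (hl : 2 * l ≤ N) :
    √((dimIrrep (twoRow N l hl).1 : ℝ) * (multIrrep 2 (twoRow N l hl).1 : ℝ)) =
      ((N : ℝ) - 2 * l + 1) / √((N : ℝ) + 1) * √((N + 1).choose l : ℝ) := by
  have hl' : (2 * l : ℝ) ≤ N := by exact_mod_cast hl
  have hb := ballot_mul N l (by omega)
  have hm : ((N - 2 * l + 1 : ℕ) : ℝ) = (N : ℝ) - 2 * l + 1 := by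
    rw [Nat.cast_add, Nat.cast_sub hl]; push_cast; ring
  have hN : (0 : ℝ) < (N : ℝ) + 1 := by positivity
  have key : (ballot N l : ℝ) * ((N : ℝ) - 2 * l + 1) =
      ((N : ℝ) - 2 * l + 1) ^ 2 / ((N : ℝ) + 1) * (N + 1).choose l := by
    field_simp
    linear_combination ((N : ℝ) - 2 * l + 1) * hb
  rw [dimIrrep_twoRow, multIrrep_twoRow, hm, key, Real.sqrt_mul (by positivity),
    Real.sqrt_div (by positivity), Real.sqrt_sq (by linarith)]

theorem sqrt_choose_factorial (N l : ℕ) (hl : l ≤ N + 1) :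
    1 / √((2 : ℝ) ^ N) * (1 / √(((N : ℝ) + 2) / 4)) * (1 / √((N : ℝ) + 1)) *
        √((N + 1).choose l : ℝ) =
      √((N.factorial : ℝ) / ((2 : ℝ) ^ ((N : ℤ) - 2) * ((N : ℝ) + 2))) /
        √((l.factorial : ℝ) * ((N + 1 - l).factorial : ℝ)) := by
  have hfac : ((N + 1).choose l : ℝ) * l.factorial * (N + 1 - l).factorial =
      (N + 1) * N.factorial := by
    have := Nat.choose_mul_factorial_mul_factorial hl
    rw [Nat.factorial_succ] at this
    exact_mod_cast this
  -- The exponent is an integer because it is negative for `N = 1`; the factor 4 matches the one in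
  -- `(N + 2)/4`.
  have h2 : (2 : ℝ) ^ ((N : ℤ) - 2) = 2 ^ N / 4 := by
    rw [zpow_sub₀ two_ne_zero, zpow_natCast]; norm_num
  have hl0 : (0 : ℝ) < l.factorial := by positivity
  have hl1 : (0 : ℝ) < (N + 1 - l).factorial := by positivity
  rw [h2, ← Real.sqrt_div (by positivity)]
  simp only [one_div, ← Real.sqrt_inv]
  rw [← Real.sqrt_mul (by positivity), ← Real.sqrt_mul (by positivity),
    ← Real.sqrt_mul (by positivity)]
  congr 1
  field_simp
  linear_combination hfac

theorem fidelity_qubit {N : ℕ} (hN : 1 ≤ N) {v : Frame N 2 → ℝ} (hv : IsOptimalVector v) :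
    fidelity (resource N 2) (optimalResource v) =
      1 / √((2 : ℝ) ^ N) * ∑ l ∈ Finset.range (N / 2 + 1),
        qubitCoeff N l * (((N : ℝ) - 2 * l + 1) / √((N : ℝ) + 1)) * √((N + 1).choose l : ℝ) := by
  rw [fidelity_resource_optimalResource hv.nonneg, Nat.cast_ofNat]
  congr 1
  refine sum_frame_eq_sum_range fun l hl => ?_
  rw [hv.apply_twoRow hN, sqrt_dimIrrep_mul_multIrrep, mul_assoc]

theorem sum_qubitCoeff_eq {N : ℕ} (hN : 1 ≤ N) :
    1 / √((2 : ℝ) ^ N) * ∑ l ∈ Finset.range (N / 2 + 1),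
        qubitCoeff N l * (((N : ℝ) - 2 * l + 1) / √((N : ℝ) + 1)) * √((N + 1).choose l : ℝ) =
      √((N.factorial : ℝ) / ((2 : ℝ) ^ ((N : ℤ) - 2) * ((N : ℝ) + 2))) *
        ∑ k ∈ Finset.range (N + 1) with k % 2 = N % 2,
          ((k : ℝ) + 1) * Real.sin (Real.pi * ((k : ℝ) + 1) / ((N : ℝ) + 2)) /
            √((((N - k) / 2).factorial : ℝ) * (((N + k) / 2 + 1).factorial : ℝ)) := by
  rw [Finset.mul_sum, Finset.mul_sum]
  -- The index is `k = N - 2l = 2j`; the parity condition makes the halvings exact.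
  refine Finset.sum_bij' (fun l _ => N - 2 * l) (fun k _ => (N - k) / 2) ?_ ?_ ?_ ?_ ?_
  · intro l hl
    rw [Finset.mem_range] at hl
    rw [Finset.mem_filter, Finset.mem_range]
    omega
  · intro k hk
    rw [Finset.mem_filter, Finset.mem_range] at hk
    rw [Finset.mem_range]
    omega
  · intro l hl
    rw [Finset.mem_range] at hl
    omega
  · intro k hk
    rw [Finset.mem_filter, Finset.mem_range] at hk
    omega
  · intro l hl
    rw [Finset.mem_range] at hl
    have hk : ((N - 2 * l : ℕ) : ℝ) = N - 2 * l := by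
      rw [Nat.cast_sub (by omega)]; push_cast; ring
    have hs : Real.sin (Real.pi * (((N : ℝ) - 2 * l) + 1) / ((N : ℝ) + 2)) = sineCoeff N l := by
      rw [sineCoeff]; congr 1; ring
    rw [hk, hs, qubitCoeff_eq hN (by omega), sum_sineCoeff_sq N hN,
      show (N - (N - 2 * l)) / 2 = l by omega,
      show (N + (N - 2 * l)) / 2 + 1 = N + 1 - l by omega]
    linear_combination sineCoeff N l * ((N : ℝ) - 2 * l + 1) *
      sqrt_choose_factorial N l (by omega)

end PBT

end

theorem lemma4 (N : ℕ) (hN : 1 ≤ N) :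
    (∀ (d : ℕ), 1 ≤ d → ∀ v : PBT.Frame N d → ℝ, PBT.IsOptimalVector v →
      PBT.fidelity (PBT.resource N d) (PBT.optimalResource v) =
        1 / √((d : ℝ) ^ N) *
          ∑ μ : PBT.Frame N d,
            v μ * √((PBT.dimIrrep μ.1 : ℝ) * (PBT.multIrrep d μ.1 : ℝ))) ∧
    (∀ v : PBT.Frame N 2 → ℝ, PBT.IsOptimalVector v →
      (∀ (l : ℕ) (hl : 2 * l ≤ N), v (PBT.twoRow N l hl) = PBT.qubitCoeff N l) ∧
      PBT.fidelity (PBT.resource N 2) (PBT.optimalResource v) =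
        1 / √((2 : ℝ) ^ N) *
          ∑ l ∈ Finset.range (N / 2 + 1),
            PBT.qubitCoeff N l * (((N : ℝ) - 2 * l + 1) / √((N : ℝ) + 1)) *
              √((N + 1).choose l : ℝ) ∧
      -- the index `k` is twice the spin quantum number `j`
      PBT.fidelity (PBT.resource N 2) (PBT.optimalResource v) =
        √((N.factorial : ℝ) / ((2 : ℝ) ^ ((N : ℤ) - 2) * ((N : ℝ) + 2))) *
          ∑ k ∈ Finset.range (N + 1) with k % 2 = N % 2,
            ((k : ℝ) + 1) * Real.sin (Real.pi * ((k : ℝ) + 1) / ((N : ℝ) + 2)) /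
              √((((N - k) / 2).factorial : ℝ) * (((N + k) / 2 + 1).factorial : ℝ))) :=
  ⟨fun _ _ _ hv => PBT.fidelity_resource_optimalResource hv.nonneg, fun _ hv =>
    ⟨hv.apply_twoRow hN, PBT.fidelity_qubit hN hv,
      (PBT.fidelity_qubit hN hv).trans (PBT.sum_qubitCoeff_eq hN)⟩⟩
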